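/- Let $n \ge 2$ and $K \ge 3$. Identify $\mathbb{C}^{n(n-1)/2}$ with the set of upper unitriangular complex $n\times n$ matrices $A$ (via the entries above the diagonal) and $\mathbb{C}^{n(n+1)/2}$ with the set of symmetric complex $n\times n$ matrices $Z$, and put $$M^-(A,Z)=\begin{bmatrix} I_n&0\\ Z&I_n\end{bmatrix}\begin{bmatrix}A^{-T}&0\\0&A\end{bmatrix},\qquad M^+(A,Z)=\begin{bmatrix} I_n&Z\\ 0&I_n\end{bmatrix}\begin{bmatrix}A^{-1}&0\\0&A^{T}\end{bmatrix}.$$ On $(\mathbb{C}^{n(n-1)/2}\times\mathbb{C}^{n(n+1)/2})^K$, whose points are written $((A_1,Z_1),\dots,(A_K,Z_K))$, let $\Psi_K = M^-(A_1,Z_1)M^+(A_2,Z_2)\cdots M^{\pm}(A_K,Z_K)$ (the signs alternate), let $\Phi_K$ be the last row of $\Psi_K$, and let $$S_K=\{Z_ie_n=0 \text{ for } 1\le i<K,\ \ A_je_n=e_n \text{ for } 1<j<K\},$$ where $e_n$ is the last standard basis vector of $\mathbb{C}^n$. Then $$\Phi_K:\ (\mathbb{C}^{n(n-1)/2}\times\mathbb{C}^{n(n+1)/2})^K\setminus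 S_K\ \longrightarrow\ \mathbb{C}^{2n}\setminus\{0\}$$ is a surjective stratified elliptic submersion. Here a holomorphic map $h:Z\to X$ of complex manifolds is a submersion if near every point of $Z$ it is equivalent, via a fiber preserving biholomorphic map, to a projection $U\times V\to U$ with $U\subset X$ open and $V$ open in some $\mathbb{C}^d$. A dominating fiber spray associated with a submersion $h: Z\to X$ is a triple $(E,p,s)$ of a holomorphic vector bundle $p:E\to Z$ and a holomorphic map $s:E\to Z$ such that for every $z\in Z$: $s(E_z)\subset h^{-1}(h(z))$, $s(0_z)=z$, and $Ds(0_z)$ maps $E_z\subset T_{0_z}E$ onto $\ker Dh(z)$. The submersion $h$ is stratified elliptic if there is a descending chain of closed complex subspaces $X=X_m\supset\cdots\supset X_0\supset X_{-1}=\emptyset$ such that each stratum $Y_k=X_k\setminus X_{k-1}$, $0\le k\le m$, is regular (a complex submanifold) and every point of $Y_k$ has an open neighborhood $U$ in $Y_k$ such that the restricted submersion $h:h^{-1}(U)\to U$ admits a dominating fiber spray. -/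

import Mathlib

open scoped Topology Matrix

/-! ### Stratified elliptic submersions

Source and target are open subsets `Z`, `X` of finite-dimensional complex normed spaces. The
strata and the pieces `Z|_U` of the source over open parts of strata are locally closed complex
submanifolds; a map on such a subset is holomorphic if it is locally the restriction of a
holomorphic map of the ambient space. -/

/-- `f : M → H` is holomorphic at `m`, where the complex structure of `M` is the one it inherits
from the ambient space `G` along the inclusion `j : M → G`: near `m`, `f` is the restriction of a
map that is holomorphic on a neighbourhood of `j m` in `G`. -/
def HolomorphicAlongAt {M G H : Type*} [TopologicalSpace M]
    [NormedAddCommGroup G] [NormedSpace ℂ G] [NormedAddCommGroup H] [NormedSpace ℂ H]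
    (j : M → G) (f : M → H) (m : M) : Prop :=
  ∃ g : G → H, AnalyticAt ℂ g (j m) ∧ ∀ᶠ y in 𝓝 m, f y = g (j y)

section Definitions

variable {E F : Type*} [NormedAddCommGroup E] [NormedSpace ℂ E]
  [NormedAddCommGroup F] [NormedSpace ℂ F]

/-- `h : Z → X` is a holomorphic submersion between the open sets `Z ⊆ E` and `X ⊆ F`: it is
holomorphic, and near each point of `Z` it is equivalent, via a fibre preserving biholomorphic
map `φ`, to a projection `U × V → U` with `U ⊆ X` open and `V` open in some `ℂᵈ`. -/
structure IsHolomorphicSubmersion (h : E → F) (Z : Set E) (X : Set F) : Prop where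
  isOpen_source : IsOpen Z
  isOpen_target : IsOpen X
  mapsTo : Set.MapsTo h Z X
  holomorphic : AnalyticOnNhd ℂ h Z
  locally_projection : ∀ z₀ ∈ Z, ∃ (d : ℕ) (φ : OpenPartialHomeomorph E (F × (Fin d → ℂ)))
    (U : Set F) (V : Set (Fin d → ℂ)),
      z₀ ∈ φ.source ∧ φ.source ⊆ Z ∧
      IsOpen U ∧ U ⊆ X ∧ IsOpen V ∧ φ.target = U ×ˢ V ∧
      AnalyticOnNhd ℂ φ φ.source ∧ AnalyticOnNhd ℂ φ.symm φ.target ∧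
      ∀ z ∈ φ.source, (φ z).1 = h z

/-- `A` is a closed (reduced) complex subspace of the open set `X`: near every point of `X`
it is the common zero set of finitely many holomorphic functions. -/
def IsClosedComplexSubspace (A X : Set F) : Prop :=
  A ⊆ X ∧ ∀ x ∈ X, ∃ (U : Set F) (r : ℕ) (f : F → Fin r → ℂ),
    IsOpen U ∧ x ∈ U ∧ U ⊆ X ∧ AnalyticOnNhd ℂ f U ∧ A ∩ U = {y ∈ U | f y = 0}

/-- `Y` is regular, i.e. a locally closed complex submanifold: near each of its points it is the
zero set of a holomorphic map to some `ℂᶜ` with surjective differential. -/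
def IsRegularSubspace (Y : Set F) : Prop :=
  ∀ y ∈ Y, ∃ (U : Set F) (c : ℕ) (f : F → Fin c → ℂ),
    IsOpen U ∧ y ∈ U ∧ AnalyticOnNhd ℂ f U ∧
    (∀ u ∈ U, Function.Surjective (fderiv ℂ f u)) ∧ Y ∩ U = {u ∈ U | f u = 0}

/-- A holomorphic vector bundle of rank `r` over the complex submanifold `W` of `E`, given by an
open cover of `W` with a cocycle of holomorphic transition functions. Its total space is
`B.toVectorBundleCore.TotalSpace`. -/
structure HolomorphicVectorBundle (W : Set E) (r : ℕ) (ι : Type*) extends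
    VectorBundleCore ℂ W (Fin r → ℂ) ι where
  holomorphic_coordChange : ∀ i j, ∀ z ∈ baseSet i ∩ baseSet j,
    HolomorphicAlongAt (fun w : W => (w : E)) (coordChange i j) z

/-- The data `(B, p, s)`, with `p` the bundle projection of `B`, form a dominating fibre spray
on `W ⊆ Z` associated with the submersion `h : Z → X`; here `W = Z ∩ h⁻¹(U)` is the part of the
source over some submanifold `U` of `X`, so that the fibre of `h` through `z ∈ W`, and hence the
vertical tangent space `ker Dh(z)`, are the same for `h` and for its restriction to `W`. -/
structure IsDominatingFiberSpray (h : E → F) (Z W : Set E) {r : ℕ} {ι : Type*}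
    (B : HolomorphicVectorBundle W r ι) (s : B.TotalSpace → E) : Prop where
  /-- `s` is holomorphic in every local trivialization of `B`. -/
  holomorphic : ∀ (i : ι) (z : W), z ∈ B.baseSet i → ∀ v : Fin r → ℂ,
    HolomorphicAlongAt (fun p : W × (Fin r → ℂ) => ((p.1 : E), p.2))
      (fun p => s ((B.localTriv i).toOpenPartialHomeomorph.symm p)) (z, v)
  /-- `s(E_z) ⊆ Z_{h(z)}` -/
  map_fiber : ∀ (z : W) (v : B.Fiber z), s ⟨z, v⟩ ∈ Z ∧ h (s ⟨z, v⟩) = h z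
  /-- `s(0_z) = z` -/
  map_zero : ∀ z : W, s ⟨z, 0⟩ = z
  /-- `Ds(0_z)` maps `E_z` onto the vertical tangent space at `z`. -/
  dominating : ∀ z : W,
    LinearMap.range (fderiv ℂ (fun v : Fin r → ℂ => s ⟨z, v⟩) 0).toLinearMap =
      LinearMap.ker (fderiv ℂ h z).toLinearMap

/-- The strata `Y_k = X_k \ X_{k-1}` of an increasing sequence of sets, with `X_{-1} = ∅`. -/
def stratum (Xs : ℕ → Set F) : ℕ → Set F
  | 0 => Xs 0
  | k + 1 => Xs (k + 1) \ Xs k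

/-- `h : Z → X` is a stratified elliptic submersion of `Z` onto `X`. -/
structure IsStratifiedEllipticSubmersion (h : E → F) (Z : Set E) (X : Set F) : Prop where
  submersion : IsHolomorphicSubmersion h Z X
  surjective : Set.SurjOn h Z X
  stratified : ∃ (m : ℕ) (Xs : ℕ → Set F),
    Xs m = X ∧ (∀ k < m, Xs k ⊆ Xs (k + 1)) ∧
    (∀ k ≤ m, IsClosedComplexSubspace (Xs k) X) ∧
    ∀ k ≤ m, IsRegularSubspace (stratum Xs k) ∧
      ∀ x ∈ stratum Xs k, ∃ U : Set F, IsOpen U ∧ x ∈ U ∧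
        ∃ (r : ℕ) (ι : Type) (B : HolomorphicVectorBundle (Z ∩ h ⁻¹' (stratum Xs k ∩ U)) r ι)
          (s : B.TotalSpace → E), IsDominatingFiberSpray h Z _ B s

end Definitions

/-! ### The map `Φ_K` -/

/-- `ℂ^{n(n-1)/2}`: the entries above the diagonal of an upper unitriangular matrix. -/
abbrev UnitriCoord (n : ℕ) : Type := {p : Fin n × Fin n // p.1 < p.2} → ℂ

/-- `ℂ^{n(n+1)/2}`: the entries of a symmetric matrix. -/
abbrev SymCoord (n : ℕ) : Type := Sym2 (Fin n) → ℂ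

/-- The space `(ℂ^{n(n-1)/2} × ℂ^{n(n+1)/2})^K`. -/
abbrev ParamSpace (n K : ℕ) : Type := Fin K → UnitriCoord n × SymCoord n

/-- The upper unitriangular matrix with the given entries above the diagonal. -/
def unitriMatrix {n : ℕ} (a : UnitriCoord n) : Matrix (Fin n) (Fin n) ℂ :=
  Matrix.of fun i j => if h : i < j then a ⟨(i, j), h⟩ else if i = j then 1 else 0

/-- The symmetric matrix with the given entries. -/
def symMatrix {n : ℕ} (z : SymCoord n) : Matrix (Fin n) (Fin n) ℂ :=
  Matrix.of fun i j => z s(i, j)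

/-- `M⁻(A, Z)` -/
noncomputable def elemMinus {n : ℕ} (A Z : Matrix (Fin n) (Fin n) ℂ) :
    Matrix (Fin n ⊕ Fin n) (Fin n ⊕ Fin n) ℂ :=
  Matrix.fromBlocks 1 0 Z 1 * Matrix.fromBlocks (A⁻¹)ᵀ 0 0 A

/-- `M⁺(A, Z)` -/
noncomputable def elemPlus {n : ℕ} (A Z : Matrix (Fin n) (Fin n) ℂ) :
    Matrix (Fin n ⊕ Fin n) (Fin n ⊕ Fin n) ℂ :=
  Matrix.fromBlocks 1 Z 0 1 * Matrix.fromBlocks A⁻¹ 0 0 Aᵀ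

/-- `Ψ_K = M⁻(A₁, Z₁) M⁺(A₂, Z₂) ⋯ M^±(A_K, Z_K)`; the factor with (zero-based) index `k` is of
type `M⁻` if `k` is even and of type `M⁺` if `k` is odd. -/
noncomputable def psiMap (n K : ℕ) (x : ParamSpace n K) :
    Matrix (Fin n ⊕ Fin n) (Fin n ⊕ Fin n) ℂ :=
  (List.ofFn fun k : Fin K =>
    if Even (k : ℕ) then elemMinus (unitriMatrix (x k).1) (symMatrix (x k).2)
    else elemPlus (unitriMatrix (x k).1) (symMatrix (x k).2)).prod

/-- The last standard basis vector `e_n` of `ℂⁿ`. -/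
def lastVec (n : ℕ) : Fin n → ℂ := fun i => if (i : ℕ) + 1 = n then 1 else 0

/-- `Φ_K = π_{2n} ∘ Ψ_K`, the last row `e_{2n}ᵀ Ψ_K` of `Ψ_K`. -/
noncomputable def phiMap (n K : ℕ) (x : ParamSpace n K) : Fin n ⊕ Fin n → ℂ :=
  Sum.elim 0 (lastVec n) ᵥ* psiMap n K x

/-- `S_K = {Z_i e_n = 0 for i < K, A_j e_n = e_n for 1 < j < K}` (with indices `1, …, K`; the
zero-based index `k` stands for `k + 1`). -/
def singSet (n K : ℕ) : Set (ParamSpace n K) :=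
  {x | (∀ k : Fin K, (k : ℕ) + 1 < K → symMatrix (x k).2 *ᵥ lastVec n = 0) ∧
    ∀ k : Fin K, 0 < (k : ℕ) → (k : ℕ) + 1 < K → unitriMatrix (x k).1 *ᵥ lastVec n = lastVec n}

/-!
The target is stratified by the first nonzero coordinate `d` of a row `v`, in the order of the
coordinates for which the last factor of `Ψ_K` is unitriangular. Let `f` be the coordinate `d` of
the row behind the first `K - 1` factors. The fibre over `v` lies in the level set `{f = v d}` and
is a holomorphic retract of it: adjust the factor `K - 1` until the row behind it vanishes in front
of `d`, then the last factor until the final row is `v`. Since `f` is affine in each of finitely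
many spanning directions, the fields `(D_j f) ∂_i - (D_i f) ∂_j` have complete holomorphic flows
which preserve `f`; composed and followed by the retraction they form a spray on the fibre, and it
dominates wherever some difference `D_i f` is nonzero. At a point of the fibre where all of them
vanish, and likewise where `Φ_K` is not a submersion, some functional is critical on the orbit of
every single factor; pairing the row in front of a factor with the column behind it then shows
that the inner factors fix the last basis vector from both sides, which puts the point in `S_K`.
-/

/-! ### Submersions and fibre sprays -/

section Submersion

variable {𝕜 E F G : Type*} [RCLike 𝕜] [NormedAddCommGroup E] [NormedSpace 𝕜 E]
  [NormedAddCommGroup F] [NormedSpace 𝕜 F] [NormedAddCommGroup G] [NormedSpace 𝕜 G]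

theorem exists_continuousLinearEquiv_coe_eq_prod [FiniteDimensional 𝕜 E] {L : E →L[𝕜] F}
    (hL : Function.Surjective L) :
    ∃ (d : ℕ) (π : E →L[𝕜] (Fin d → 𝕜)) (T : E ≃L[𝕜] F × (Fin d → 𝕜)),
      (T : E →L[𝕜] F × (Fin d → 𝕜)) = L.prod π := by
  have : FiniteDimensional 𝕜 F := Module.Finite.of_surjective L.toLinearMap hL
  have : CompleteSpace E := FiniteDimensional.complete 𝕜 E
  have : CompleteSpace F := FiniteDimensional.complete 𝕜 F
  obtain ⟨proj, hproj⟩ := L.ker_closedComplemented_of_finiteDimensional_range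
  let b : L.ker ≃L[𝕜] (Fin (Module.finrank 𝕜 L.ker) → 𝕜) :=
    ContinuousLinearEquiv.ofFinrankEq (by simp)
  let π : E →L[𝕜] (Fin (Module.finrank 𝕜 L.ker) → 𝕜) := (b : L.ker →L[𝕜] _).comp proj
  have hker : π.ker = proj.ker := by ext x; simp [π]
  have hsurj : Function.Surjective π := b.surjective.comp fun y => ⟨y, hproj y⟩
  exact ⟨_, π, ContinuousLinearMap.equivProdOfSurjectiveOfIsCompl L π (LinearMap.range_eq_top.2 hL)
    (LinearMap.range_eq_top.2 hsurj) (hker ▸ LinearMap.isCompl_of_proj hproj), rfl⟩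

open scoped ContDiff in
theorem exists_openPartialHomeomorph_of_hasFDerivAt_equiv [CompleteSpace E] [CompleteSpace F]
    {g : E → F} {Z : Set E} (hZ : IsOpen Z) (hg : AnalyticOnNhd 𝕜 g Z) {z : E} (hz : z ∈ Z)
    {T : E ≃L[𝕜] F} (hT : HasFDerivAt g (T : E →L[𝕜] F) z) :
    ∃ φ : OpenPartialHomeomorph E F, ⇑φ = g ∧ z ∈ φ.source ∧ φ.source ⊆ Z ∧
      AnalyticOnNhd 𝕜 φ.symm φ.target := by
  have hgz : ContDiffAt 𝕜 ω g z := (hg z hz).contDiffAt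
  let φ₀ := hgz.toOpenPartialHomeomorph g hT (by simp)
  have hz₀ : z ∈ φ₀.source := hgz.mem_toOpenPartialHomeomorph_source hT (by simp)
  have hsymm : AnalyticAt 𝕜 φ₀.symm (g z) := (hgz.to_localInverse hT (by simp)).analyticAt
  let φ₁ := φ₀.restrOpen Z hZ
  let φ := (φ₁.symm.restrOpen {y | AnalyticAt 𝕜 φ₀.symm y} (isOpen_analyticAt 𝕜 φ₀.symm)).symm
  have hz' : z ∈ φ₁.source := ⟨hz₀, hz⟩
  have hz₁ : z ∈ φ.source := by
    have hmem : φ₁.symm (φ₁ z) ∈ φ.source := φ.map_target ⟨φ₁.map_source hz', hsymm⟩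
    rwa [φ₁.left_inv hz'] at hmem
  exact ⟨φ, rfl, hz₁, fun x hx => hx.1.2, fun y hy => hy.2⟩

theorem exists_openPartialHomeomorph_target_eq_prod (φ : OpenPartialHomeomorph E (F × G)) {z : E}
    (hz : z ∈ φ.source) {X : Set F} (hX : IsOpen X) (hzX : (φ z).1 ∈ X) :
    ∃ (ψ : OpenPartialHomeomorph E (F × G)) (U : Set F) (V : Set G), ⇑ψ = φ ∧ ⇑ψ.symm = φ.symm ∧
      z ∈ ψ.source ∧ ψ.source ⊆ φ.source ∧ ψ.target ⊆ φ.target ∧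
      IsOpen U ∧ U ⊆ X ∧ IsOpen V ∧ ψ.target = U ×ˢ V := by
  obtain ⟨U, V, hU, hV, hzU, hzV, hsub⟩ := isOpen_prod_iff.1
    (φ.open_target.inter (hX.preimage continuous_fst)) _ _ ⟨φ.map_source hz, hzX⟩
  let ψ := (φ.symm.restrOpen (U ×ˢ V) (hU.prod hV)).symm
  have htarget : ψ.target = U ×ˢ V := Set.inter_eq_right.2 fun y hy => (hsub hy).1
  exact ⟨ψ, U, V, rfl, rfl, ⟨hz, φ.left_inv hz ▸ hzU, hzV⟩, fun x hx => hx.1, fun y hy => hy.1,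
    hU, fun u hu => (hsub (show (u, (φ z).2) ∈ U ×ˢ V from ⟨hu, hzV⟩)).2, hV, htarget⟩

end Submersion

section HolomorphicSubmersion

variable {E F H : Type*} [NormedAddCommGroup E] [NormedSpace ℂ E]
  [NormedAddCommGroup F] [NormedSpace ℂ F] [NormedAddCommGroup H] [NormedSpace ℂ H]

theorem isHolomorphicSubmersion_of_surjective_fderiv [FiniteDimensional ℂ E]
    {h : E → F} {Z : Set E} {X : Set F}
    (hZ : IsOpen Z) (hX : IsOpen X) (hmaps : Set.MapsTo h Z X) (hh : AnalyticOnNhd ℂ h Z)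
    (hsurj : ∀ z ∈ Z, Function.Surjective (fderiv ℂ h z)) :
    IsHolomorphicSubmersion h Z X := by
  refine ⟨hZ, hX, hmaps, hh, fun z₀ hz₀ => ?_⟩
  have : FiniteDimensional ℂ F := Module.Finite.of_surjective (fderiv ℂ h z₀).toLinearMap
    (hsurj z₀ hz₀)
  have : CompleteSpace E := FiniteDimensional.complete ℂ E
  have : CompleteSpace F := FiniteDimensional.complete ℂ F
  obtain ⟨d, π, T, hT⟩ := exists_continuousLinearEquiv_coe_eq_prod (hsurj z₀ hz₀)
  let g : E → F × (Fin d → ℂ) := fun x => (h x, π x)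
  have hg : AnalyticOnNhd ℂ g Z := fun z hz => (hh z hz).prod (π.analyticAt z)
  have hTg : HasFDerivAt g (T : E →L[ℂ] F × (Fin d → ℂ)) z₀ :=
    hT ▸ (hh z₀ hz₀).differentiableAt.hasFDerivAt.prodMk π.hasFDerivAt
  obtain ⟨φ, hφ, hzφ, hφZ, hφsymm⟩ :=
    exists_openPartialHomeomorph_of_hasFDerivAt_equiv hZ hg hz₀ hTg
  obtain ⟨ψ, U, V, hψ, hψsymm, hzψ, hsource, htarget, hU, hUX, hV, hUV⟩ :=
    exists_openPartialHomeomorph_target_eq_prod φ hzφ hX (by simpa only [hφ] using hmaps hz₀)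
  refine ⟨d, ψ, U, V, hzψ, hsource.trans hφZ, hU, hUX, hV, hUV, ?_, ?_, fun z _ => ?_⟩
  · rw [hψ, hφ]
    exact hg.mono (hsource.trans hφZ)
  · rw [hψsymm]
    exact hφsymm.mono htarget
  · rw [hψ, hφ]

theorem IsHolomorphicSubmersion.exists_fiber_parametrization {h : E → F} {Z : Set E} {X : Set F}
    (hh : IsHolomorphicSubmersion h Z X) {z : E} (hz : z ∈ Z) :
    ∃ (d : ℕ) (γ : (Fin d → ℂ) → E) (w : Fin d → ℂ), γ w = z ∧ DifferentiableAt ℂ γ w ∧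
      (∀ᶠ w' in 𝓝 w, γ w' ∈ Z ∧ h (γ w') = h z) ∧
      ∀ δ, fderiv ℂ h z δ = 0 → ∃ τ, fderiv ℂ γ w τ = δ := by
  obtain ⟨d, φ, U, V, hzφ, hφZ, -, -, -, -, hφ, hφsymm, hφh⟩ := hh.locally_projection z hz
  have hpair : (h z, (φ z).2) = φ z := by rw [← hφh z hzφ]
  have htarget : (h z, (φ z).2) ∈ φ.target := hpair ▸ φ.map_source hzφ
  have hleft : φ.symm (h z, (φ z).2) = z := by rw [hpair, φ.left_inv hzφ]
  have hDφ : HasFDerivAt φ (fderiv ℂ φ z) z := (hφ z hzφ).differentiableAt.hasFDerivAt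
  have hDsymm := (hφsymm _ htarget).differentiableAt.hasFDerivAt
  have hDγ := hDsymm.comp (φ z).2 (hasFDerivAt_prodMk_right (h z) (φ z).2)
  have hfst (δ : E) : (fderiv ℂ φ z δ).1 = fderiv ℂ h z δ := by
    have heq : h =ᶠ[𝓝 z] fun x => (φ x).1 := by
      filter_upwards [φ.open_source.mem_nhds hzφ] with x hx using (hφh x hx).symm
    rw [(hDφ.fst.congr_of_eventuallyEq heq).fderiv]
    rfl
  have hinv (δ : E) : fderiv ℂ φ.symm (h z, (φ z).2) (fderiv ℂ φ z δ) = δ := by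
    have heq : id =ᶠ[𝓝 z] φ.symm ∘ φ := by
      filter_upwards [φ.open_source.mem_nhds hzφ] with x hx using (φ.left_inv hx).symm
    rw [hpair] at hDsymm ⊢
    exact DFunLike.congr_fun
      (((hDsymm.comp z hDφ).congr_of_eventuallyEq heq).unique (hasFDerivAt_id z)) δ
  refine ⟨d, fun w => φ.symm (h z, w), (φ z).2, hleft, hDγ.differentiableAt, ?_, fun δ hδ =>
    ⟨(fderiv ℂ φ z δ).2, ?_⟩⟩
  · filter_upwards [(Continuous.prodMk_right (h z)).continuousAt.eventually_mem
      (φ.open_target.mem_nhds htarget)] with w hw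
    refine ⟨hφZ (φ.map_target hw), ?_⟩
    rw [← hφh _ (φ.map_target hw), φ.right_inv hw]
  · rw [show fderiv ℂ (fun w => φ.symm (h z, w)) (φ z).2 = _ from hDγ.fderiv]
    conv_rhs => rw [← hinv δ, ← Prod.mk.eta (p := fderiv ℂ φ z δ), hfst, hδ]
    rfl

theorem IsHolomorphicSubmersion.fderiv_eq_of_eqOn_fiber {h : E → F} {Z : Set E} {X : Set F}
    (hh : IsHolomorphicSubmersion h Z X) {z : E} (hz : z ∈ Z) {f g : E → H}
    (hf : DifferentiableAt ℂ f z) (hg : DifferentiableAt ℂ g z)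
    (hfg : Set.EqOn f g {x ∈ Z | h x = h z}) {δ : E} (hδ : fderiv ℂ h z δ = 0) :
    fderiv ℂ f z δ = fderiv ℂ g z δ := by
  obtain ⟨d, γ, w, rfl, hγ, hfiber, hker⟩ := hh.exists_fiber_parametrization hz
  obtain ⟨τ, rfl⟩ := hker δ hδ
  have heq : f ∘ γ =ᶠ[𝓝 w] g ∘ γ := hfiber.mono fun w' hw' => hfg hw'
  rw [← ContinuousLinearMap.comp_apply, ← ContinuousLinearMap.comp_apply, ← fderiv_comp w hf hγ,
    ← fderiv_comp w hg hγ, heq.fderiv_eq]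

end HolomorphicSubmersion

section Spray

variable {E F : Type*} [NormedAddCommGroup E] [NormedSpace ℂ E]
  [NormedAddCommGroup F] [NormedSpace ℂ F]

/-- The restricted submersion `h : W → h(W)` admits a dominating fibre spray. -/
def AdmitsDominatingFiberSpray (h : E → F) (Z W : Set E) : Prop :=
  ∃ (r : ℕ) (ι : Type) (B : HolomorphicVectorBundle W r ι) (s : B.TotalSpace → E),
    IsDominatingFiberSpray h Z W B s

/-- The product bundle `W × ℂʳ`, with a single chart; it carries all the sprays below. -/
noncomputable def trivialHolomorphicBundle (W : Set E) (r : ℕ) :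
    HolomorphicVectorBundle W r Unit where
  toVectorBundleCore :=
    { baseSet := fun _ => Set.univ
      isOpen_baseSet := fun _ => isOpen_univ
      indexAt := fun _ => ()
      mem_baseSet_at := fun _ => Set.mem_univ _
      coordChange := fun _ _ _ => ContinuousLinearMap.id ℂ _
      coordChange_self := fun _ _ _ _ => rfl
      continuousOn_coordChange := fun _ _ => continuousOn_const
      coordChange_comp := fun _ _ _ _ _ _ => rfl }
  holomorphic_coordChange := fun _ _ _ _ =>
    ⟨fun _ => ContinuousLinearMap.id ℂ _, analyticAt_const, .of_forall fun _ => rfl⟩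

theorem admitsDominatingFiberSpray_of_holomorphic_family {V : Type*} [NormedAddCommGroup V]
    [NormedSpace ℂ V] [FiniteDimensional ℂ V] {h : E → F} {Z W : Set E} (σ : E → V → E)
    (hσ : ∀ z ∈ W, ∀ v, AnalyticAt ℂ (fun p : E × V => σ p.1 p.2) (z, v))
    (hh : ∀ z ∈ W, DifferentiableAt ℂ h z)
    (hfiber : ∀ z ∈ W, ∀ v, σ z v ∈ Z ∧ h (σ z v) = h z)
    (hzero : ∀ z ∈ W, σ z 0 = z)
    (hdom : ∀ z ∈ W, ∀ δ, fderiv ℂ h z δ = 0 → ∃ v, fderiv ℂ (σ z) 0 v = δ) :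
    AdmitsDominatingFiberSpray h Z W := by
  let e : (Fin (Module.finrank ℂ V) → ℂ) ≃L[ℂ] V := ContinuousLinearEquiv.ofFinrankEq (by simp)
  refine ⟨_, Unit, trivialHolomorphicBundle W _, fun p => σ (p.1 : E) (e p.2), ?_,
    fun z v => hfiber z z.2 _, fun z => ?_, fun z => le_antisymm ?_ fun δ hδ => ?_⟩
  · intro i z _ v
    refine ⟨fun p => σ p.1 (e p.2), ?_, .of_forall fun y => rfl⟩
    have he : AnalyticAt ℂ e v := (e : _ →L[ℂ] V).analyticAt v
    exact AnalyticAt.fun_comp (g := fun p : E × V => σ p.1 p.2)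
      (f := fun p : E × (Fin _ → ℂ) => (p.1, e p.2)) (hσ z z.2 (e v))
      (analyticAt_fst.prod (he.fun_comp analyticAt_snd))
  · change σ z (e 0) = z
    rw [map_zero, hzero z z.2]
  · have hσz : DifferentiableAt ℂ (fun v => σ z (e v)) 0 :=
      (hσ z z.2 _).differentiableAt.comp (0 : Fin _ → ℂ) (f := fun v => ((z : E), e v))
        ((differentiableAt_const _).prodMk e.differentiableAt)
    rintro _ ⟨v, rfl⟩
    have hhσ : HasFDerivAt (fun v => h (σ z (e v))) _ 0 :=
      HasFDerivAt.comp (0 : Fin _ → ℂ) (f := fun v => σ z (e v))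
        (by simpa only [map_zero, hzero z z.2] using (hh z z.2).hasFDerivAt) hσz.hasFDerivAt
    rw [show (fun v => h (σ z (e v))) = fun _ => h z from
      funext fun v => (hfiber z z.2 _).2] at hhσ
    exact DFunLike.congr_fun (hhσ.unique (hasFDerivAt_const _ _)) v
  · obtain ⟨v, rfl⟩ := hdom z z.2 δ hδ
    refine ⟨e.symm v, ?_⟩
    have hcomp : fderiv ℂ (σ z ∘ e) 0 = (fderiv ℂ (σ z) (e 0)).comp (e : _ →L[ℂ] V) :=
      e.comp_right_fderiv
    rw [map_zero] at hcomp
    exact (DFunLike.congr_fun hcomp _).trans (congrArg _ (e.apply_symm_apply v))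

end Spray

/-! ### Sprays from Koszul fields -/

section FlowComposition

/-- The composition of the flows `φ k` for `k` in the list `l`, each run for its own time `t k`. -/
def flowComp {T E κ : Type*} (φ : κ → T → E → E) (l : List κ) (t : κ → T) (x : E) : E :=
  l.foldr (fun k y => φ k (t k) y) x

theorem flowComp_zero {T E κ : Type*} [Zero T] {φ : κ → T → E → E} (hφ : ∀ k x, φ k 0 x = x)
    (l : List κ) (x : E) : flowComp φ l 0 x = x := by
  induction l with
  | nil => rfl
  | cons k l ih => rw [flowComp, List.foldr_cons, ← flowComp, ih, Pi.zero_apply, hφ]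

theorem flowComp_induction {T E κ : Type*} {φ : κ → T → E → E} {P : E → Prop}
    (hφ : ∀ k t x, P x → P (φ k t x)) (l : List κ) (t : κ → T) {x : E} (hx : P x) :
    P (flowComp φ l t x) := by
  induction l with
  | nil => exact hx
  | cons k l ih => exact hφ k _ _ ih

variable {𝕜 E κ : Type*} [NontriviallyNormedField 𝕜] [NormedAddCommGroup E] [NormedSpace 𝕜 E]

theorem hasFDerivAt_of_zero_eq_id {φ : 𝕜 → E → E} {x v : E}
    (hφ : DifferentiableAt 𝕜 (fun p : 𝕜 × E => φ p.1 p.2) (0, x)) (hzero : ∀ y, φ 0 y = y)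
    (hv : HasDerivAt (fun t => φ t x) v 0) :
    HasFDerivAt (fun p : 𝕜 × E => φ p.1 p.2)
      ((ContinuousLinearMap.fst 𝕜 𝕜 E).smulRight v + ContinuousLinearMap.snd 𝕜 𝕜 E) (0, x) := by
  set L := fderiv 𝕜 (fun p : 𝕜 × E => φ p.1 p.2) (0, x)
  have hspace : HasFDerivAt (fun y => φ 0 y) (L.comp (ContinuousLinearMap.inr 𝕜 𝕜 E)) x :=
    hφ.hasFDerivAt.comp x (hasFDerivAt_prodMk_right 0 x)
  have htime : HasFDerivAt (fun t => φ t x) (L.comp (ContinuousLinearMap.inl 𝕜 𝕜 E)) 0 :=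
    hφ.hasFDerivAt.comp (f := fun t => (t, x)) (0 : 𝕜) (hasFDerivAt_prodMk_left 0 x)
  simp only [hzero] at hspace
  refine hφ.hasFDerivAt.congr_fderiv (ContinuousLinearMap.prod_ext ?_ ?_)
  · rw [htime.unique hv.hasFDerivAt]
    ext
    simp
  · rw [hspace.unique (hasFDerivAt_id x)]
    ext
    simp

theorem analyticAt_flowComp [Fintype κ] {φ : κ → 𝕜 → E → E}
    (hφ : ∀ k p, AnalyticAt 𝕜 (fun p : 𝕜 × E => φ k p.1 p.2) p)
    (l : List κ) (q : E × (κ → 𝕜)) :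
    AnalyticAt 𝕜 (fun q : E × (κ → 𝕜) => flowComp φ l q.2 q.1) q := by
  induction l with
  | nil => exact analyticAt_fst
  | cons k l ih =>
    have htime : AnalyticAt 𝕜 (fun q : E × (κ → 𝕜) => q.2 k) q :=
      ((ContinuousLinearMap.proj k : (κ → 𝕜) →L[𝕜] 𝕜).analyticAt _).fun_comp analyticAt_snd
    exact (hφ k _).fun_comp (htime.prod ih)

theorem hasFDerivAt_flowComp [Finite κ] {φ : κ → 𝕜 → E → E} {x : E} {v : κ → E}
    (hφ : ∀ k, DifferentiableAt 𝕜 (fun p : 𝕜 × E => φ k p.1 p.2) (0, x))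
    (hzero : ∀ k y, φ k 0 y = y) (hv : ∀ k, HasDerivAt (fun t => φ k t x) (v k) 0) (l : List κ) :
    HasFDerivAt (fun t => flowComp φ l t x)
      ((l.map fun k => (ContinuousLinearMap.proj k : (κ → 𝕜) →L[𝕜] 𝕜).smulRight (v k)).sum) 0 := by
  cases nonempty_fintype κ
  induction l with
  | nil => exact hasFDerivAt_const x 0
  | cons k l ih =>
    have hk := hasFDerivAt_of_zero_eq_id (hφ k) (hzero k) (hv k)
    have htime : HasFDerivAt (fun t : κ → 𝕜 => t k)
        (ContinuousLinearMap.proj k : (κ → 𝕜) →L[𝕜] 𝕜) 0 :=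
      (ContinuousLinearMap.proj k : (κ → 𝕜) →L[𝕜] 𝕜).hasFDerivAt
    have hcomp := HasFDerivAt.comp (0 : κ → 𝕜) (f := fun t => (t k, flowComp φ l t x))
      (by rwa [flowComp_zero hzero]) (htime.prodMk ih)
    refine hcomp.congr_fderiv ?_
    rw [List.map_cons, List.sum_cons]
    rfl

end FlowComposition

section KoszulSpan

theorem exists_sum_smul_koszul_eq {𝕜 V ι : Type*} [Field 𝕜] [AddCommGroup V] [Module 𝕜 V]
    [Fintype ι] {D : ι → V} (hD : Submodule.span 𝕜 (Set.range D) = ⊤) (ℓ : V →ₗ[𝕜] 𝕜) {i₀ : ι}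
    (hi₀ : ℓ (D i₀) ≠ 0) {δ : V} (hδ : ℓ δ = 0) :
    ∃ T : ι × ι → 𝕜, ∑ p, T p • (ℓ (D p.2) • D p.1 - ℓ (D p.1) • D p.2) = δ := by
  classical
  obtain ⟨a, rfl⟩ := (Submodule.mem_span_range_iff_exists_fun 𝕜).1 (hD ▸ Submodule.mem_top : δ ∈ _)
  have hsum : ∑ i, a i * ℓ (D i) = 0 := by simpa only [map_sum, map_smul, smul_eq_mul] using hδ
  refine ⟨fun p => if p.2 = i₀ then a p.1 / ℓ (D i₀) else 0, ?_⟩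
  calc ∑ p : ι × ι, (if p.2 = i₀ then a p.1 / ℓ (D i₀) else 0) •
        (ℓ (D p.2) • D p.1 - ℓ (D p.1) • D p.2)
      = ∑ i, (a i • D i - (a i * ℓ (D i) / ℓ (D i₀)) • D i₀) := by
        rw [Fintype.sum_prod_type]
        refine Finset.sum_congr rfl fun i _ => ?_
        simp only [ite_smul, zero_smul, Finset.sum_ite_eq', Finset.mem_univ, if_true]
        rw [smul_sub, smul_smul, smul_smul, div_mul_cancel₀ _ hi₀, div_mul_eq_mul_div]
    _ = ∑ i, a i • D i := by
        rw [Finset.sum_sub_distrib, ← Finset.sum_smul, ← Finset.sum_div, hsum, zero_div, zero_smul,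
          sub_zero]

end KoszulSpan

section Koszul

open scoped fwdDiff

/-- `f` is affine on all lines of direction `d`. -/
def AffineAlong {R M : Type*} [CommRing R] [AddCommGroup M] [Module R M] (f : M → R) (d : M) :
    Prop :=
  ∀ (x : M) (t : R), f (x + t • d) = f x + t * Δ_[d] f x

theorem fwdDiff_comm {M G : Type*} [AddCommGroup M] [AddCommGroup G] (f : M → G) (d d' : M) :
    Δ_[d] (Δ_[d'] f) = Δ_[d'] (Δ_[d] f) := by
  ext x
  simp only [fwdDiff, add_right_comm x d d']
  abel

section

variable {R M : Type*} [CommRing R] [AddCommGroup M] [Module R M] {f : M → R} {d : M}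

theorem AffineAlong.fwdDiff (hf : AffineAlong f d) (d' : M) : AffineAlong (Δ_[d'] f) d := by
  intro x t
  simp only [_root_.fwdDiff, add_right_comm x _ d', hf _ t]
  ring

theorem AffineAlong.fwdDiff_add_smul (hf : AffineAlong f d) (x : M) (t : R) :
    Δ_[d] f (x + t • d) = Δ_[d] f x := by
  have hsucc : x + t • d + d = x + (t + 1) • d := by rw [add_smul, one_smul, add_assoc]
  rw [_root_.fwdDiff, hsucc, hf x (t + 1), hf x t]
  ring

end

theorem AffineAlong.fderiv_apply {𝕜 E : Type*} [NontriviallyNormedField 𝕜] [NormedAddCommGroup E]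
    [NormedSpace 𝕜 E] {f : E → 𝕜} {d : E} (hf : AffineAlong f d) {x : E}
    (hd : DifferentiableAt 𝕜 f x) : fderiv 𝕜 f x d = Δ_[d] f x := by
  rw [← hd.lineDeriv_eq_fderiv, lineDeriv]
  simp only [hf x]
  simp

theorem differentiable_dslope_exp : Differentiable ℂ (dslope Complex.exp 0) :=
  differentiableOn_univ.1 <| (Complex.differentiableOn_dslope Filter.univ_mem).2
    Complex.differentiable_exp.differentiableOn

/-- The integral `∫₀ᵗ exp (s b) ds = (exp (t b) - 1) / b`, without a division by `b`. -/
noncomputable def expInt (t b : ℂ) : ℂ := t * dslope Complex.exp 0 (t * b)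

theorem mul_expInt (t b : ℂ) : b * expInt t b = Complex.exp (t * b) - 1 := by
  have h := sub_smul_dslope Complex.exp 0 (t * b)
  rw [sub_zero, Complex.exp_zero, smul_eq_mul] at h
  rw [← h, expInt]
  ring

theorem expInt_zero_left (b : ℂ) : expInt 0 b = 0 := zero_mul _

theorem expInt_zero_right (t : ℂ) : expInt t 0 = t := by simp [expInt]

theorem exp_mul_expInt_neg (t b : ℂ) : Complex.exp (t * b) * expInt (-t) b = -expInt t b := by
  obtain rfl | hb := eq_or_ne b 0
  · simp [expInt_zero_right]
  · apply mul_left_cancel₀ hb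
    rw [mul_left_comm, mul_expInt, mul_neg, mul_expInt, mul_sub, ← Complex.exp_add]
    simp

theorem analyticAt_expInt (p : ℂ × ℂ) : AnalyticAt ℂ (fun p : ℂ × ℂ => expInt p.1 p.2) p := by
  exact analyticAt_fst.mul ((differentiable_dslope_exp.analyticAt _).fun_comp
    (analyticAt_fst.mul analyticAt_snd))

theorem hasDerivAt_expInt (b : ℂ) : HasDerivAt (fun t => expInt t b) 1 0 := by
  have hslope : DifferentiableAt ℂ (fun t => dslope Complex.exp 0 (t * b)) 0 :=
    (differentiable_dslope_exp _).comp (0 : ℂ) (differentiableAt_id.mul_const b)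
  have hmul := (hasDerivAt_id (0 : ℂ)).mul hslope.hasDerivAt
  simp only [id_eq, zero_mul, dslope_same, Complex.deriv_exp, Complex.exp_zero, mul_one,
    add_zero] at hmul
  exact hmul

variable {E : Type*} [NormedAddCommGroup E] [NormedSpace ℂ E] {f : E → ℂ} {d d' : E}

/-- The flow of the Koszul vector field `(Δ_[d'] f) d - (Δ_[d] f) d'` of `f`. -/
noncomputable def koszulFlow (f : E → ℂ) (d d' : E) (t : ℂ) (x : E) : E :=
  x + (Δ_[d'] f x * expInt t (Δ_[d] (Δ_[d'] f) x)) • d +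
    (Δ_[d] f x * expInt (-t) (Δ_[d] (Δ_[d'] f) x)) • d'

theorem koszulFlow_zero (f : E → ℂ) (d d' x : E) : koszulFlow f d d' 0 x = x := by
  simp [koszulFlow, expInt_zero_left]

theorem fwdDiff_koszulFlow_right (hd : AffineAlong f d) (hd' : AffineAlong f d') (t : ℂ) (x : E) :
    Δ_[d'] f (koszulFlow f d d' t x) =
      Δ_[d'] f x * Complex.exp (t * Δ_[d] (Δ_[d'] f) x) := by
  rw [koszulFlow, hd'.fwdDiff_add_smul, hd.fwdDiff d']
  linear_combination Δ_[d'] f x * mul_expInt t (Δ_[d] (Δ_[d'] f) x)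

theorem fwdDiff_koszulFlow_left (hd : AffineAlong f d) (hd' : AffineAlong f d') (t : ℂ) (x : E) :
    Δ_[d] f (koszulFlow f d d' t x) =
      Δ_[d] f x * Complex.exp (-t * Δ_[d] (Δ_[d'] f) x) := by
  rw [koszulFlow, add_right_comm, hd.fwdDiff_add_smul, hd'.fwdDiff d, fwdDiff_comm f d' d]
  linear_combination Δ_[d] f x * mul_expInt (-t) (Δ_[d] (Δ_[d'] f) x)

theorem fwdDiff_fwdDiff_koszulFlow (hd : AffineAlong f d) (hd' : AffineAlong f d') (t : ℂ)
    (x : E) : Δ_[d] (Δ_[d'] f) (koszulFlow f d d' t x) = Δ_[d] (Δ_[d'] f) x := by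
  rw [koszulFlow, fwdDiff_comm, (hd'.fwdDiff d).fwdDiff_add_smul, fwdDiff_comm,
    (hd.fwdDiff d').fwdDiff_add_smul]

theorem apply_koszulFlow (hd : AffineAlong f d) (hd' : AffineAlong f d') (t : ℂ) (x : E) :
    f (koszulFlow f d d' t x) = f x := by
  rw [koszulFlow, hd', hd, hd.fwdDiff d']
  set b := Δ_[d] (Δ_[d'] f) x
  linear_combination Δ_[d] f x * Δ_[d'] f x * expInt (-t) b * mul_expInt t b +
    Δ_[d] f x * Δ_[d'] f x * exp_mul_expInt_neg t b

theorem koszulFlow_neg_koszulFlow (hd : AffineAlong f d) (hd' : AffineAlong f d') (t : ℂ) (x : E) :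
    koszulFlow f d d' (-t) (koszulFlow f d d' t x) = x := by
  conv_lhs => rw [koszulFlow]
  rw [fwdDiff_koszulFlow_right hd hd', fwdDiff_koszulFlow_left hd hd',
    fwdDiff_fwdDiff_koszulFlow hd hd', mul_assoc, mul_assoc, exp_mul_expInt_neg,
    exp_mul_expInt_neg, koszulFlow]
  module

theorem exists_fwdDiff_koszulFlow_ne {ι : Type*} {D : ι → E} (hD : ∀ i, AffineAlong f (D i))
    (i j : ι) (t : ℂ) {x : E} (hx : ∃ k, Δ_[D k] f x ≠ 0) :
    ∃ k, Δ_[D k] f (koszulFlow f (D i) (D j) t x) ≠ 0 := by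
  -- A point where all differences vanish is fixed by the inverse flow.
  by_contra! hcrit
  have hfix := koszulFlow_neg_koszulFlow (hD i) (hD j) t x
  conv_lhs at hfix => rw [koszulFlow]
  rw [hcrit i, hcrit j, zero_mul, zero_mul, zero_smul, zero_smul, add_zero, add_zero] at hfix
  obtain ⟨k, hk⟩ := hx
  exact hk (hfix ▸ hcrit k)

theorem analyticAt_fwdDiff {f : E → ℂ} (hf : ∀ x, AnalyticAt ℂ f x) (d x : E) :
    AnalyticAt ℂ (Δ_[d] f) x :=
  ((hf (x + d)).fun_comp (f := fun y => y + d) (analyticAt_id.add analyticAt_const)).sub (hf x)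

theorem analyticAt_koszulFlow (hf : ∀ x, AnalyticAt ℂ f x) (d d' : E) (p : ℂ × E) :
    AnalyticAt ℂ (fun p : ℂ × E => koszulFlow f d d' p.1 p.2) p := by
  have hsnd {g : E → ℂ} (hg : ∀ x, AnalyticAt ℂ g x) : AnalyticAt ℂ (fun p : ℂ × E => g p.2) p :=
    (hg p.2).fun_comp analyticAt_snd
  have hexpInt {τ : ℂ × E → ℂ} (hτ : AnalyticAt ℂ τ p) :
      AnalyticAt ℂ (fun p : ℂ × E => expInt (τ p) (Δ_[d] (Δ_[d'] f) p.2)) p :=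
    (analyticAt_expInt _).fun_comp
      (hτ.prod (hsnd (analyticAt_fwdDiff (analyticAt_fwdDiff hf d') d)))
  exact (analyticAt_snd.add (((hsnd (analyticAt_fwdDiff hf d')).mul
    (hexpInt analyticAt_fst)).smul analyticAt_const)).add
    (((hsnd (analyticAt_fwdDiff hf d)).mul (hexpInt analyticAt_fst.neg)).smul analyticAt_const)

theorem hasDerivAt_koszulFlow (f : E → ℂ) (d d' x : E) :
    HasDerivAt (fun t => koszulFlow f d d' t x) (Δ_[d'] f x • d - Δ_[d] f x • d') 0 := by
  have hneg (b : ℂ) : HasDerivAt (fun t => expInt (-t) b) (-1) 0 := by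
    have hcomp := (hasDerivAt_expInt b).comp_of_eq (0 : ℂ) (hasDerivAt_neg (0 : ℂ)) neg_zero.symm
    rwa [one_mul] at hcomp
  have hsum := ((((hasDerivAt_expInt (Δ_[d] (Δ_[d'] f) x)).const_mul (Δ_[d'] f x)).smul_const
    d).const_add x).add
    (((hneg (Δ_[d] (Δ_[d'] f) x)).const_mul (Δ_[d] f x)).smul_const d')
  rw [mul_one, mul_neg_one, neg_smul, ← sub_eq_add_neg] at hsum
  exact hsum

/-- The composition of the Koszul flows for all pairs of directions `D i`, `D j`. -/
noncomputable def koszulSpray {ι : Type*} [Fintype ι] (f : E → ℂ) (D : ι → E) :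
    (ι × ι → ℂ) → E → E :=
  flowComp (fun p => koszulFlow f (D p.1) (D p.2)) Finset.univ.toList

section

variable {ι : Type*} [Fintype ι] {D : ι → E}

theorem koszulSpray_zero (f : E → ℂ) (D : ι → E) (x : E) : koszulSpray f D 0 x = x :=
  flowComp_zero (fun _ => koszulFlow_zero f _ _) _ x

theorem apply_koszulSpray (hD : ∀ i, AffineAlong f (D i)) (t : ι × ι → ℂ) (x : E) :
    f (koszulSpray f D t x) = f x :=
  flowComp_induction (P := fun y => f y = f x)
    (fun _ _ y hy => (apply_koszulFlow (hD _) (hD _) _ y).trans hy) _ _ rfl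

theorem exists_fwdDiff_koszulSpray_ne (hD : ∀ i, AffineAlong f (D i)) (t : ι × ι → ℂ) {x : E}
    (hx : ∃ k, Δ_[D k] f x ≠ 0) : ∃ k, Δ_[D k] f (koszulSpray f D t x) ≠ 0 :=
  flowComp_induction (P := fun y => ∃ k, Δ_[D k] f y ≠ 0)
    (fun _ _ _ => exists_fwdDiff_koszulFlow_ne hD _ _ _) _ _ hx

theorem analyticAt_koszulSpray (hf : ∀ x, AnalyticAt ℂ f x) (D : ι → E) (q : E × (ι × ι → ℂ)) :
    AnalyticAt ℂ (fun q : E × (ι × ι → ℂ) => koszulSpray f D q.2 q.1) q :=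
  analyticAt_flowComp (fun _ => analyticAt_koszulFlow hf _ _) _ q

theorem hasFDerivAt_koszulSpray (hf : ∀ x, AnalyticAt ℂ f x) (D : ι → E) (x : E) :
    HasFDerivAt (fun t => koszulSpray f D t x)
      (∑ p : ι × ι, (ContinuousLinearMap.proj p : (ι × ι → ℂ) →L[ℂ] ℂ).smulRight
        (Δ_[D p.2] f x • D p.1 - Δ_[D p.1] f x • D p.2)) 0 := by
  rw [← Finset.sum_map_toList]
  exact hasFDerivAt_flowComp (fun p => (analyticAt_koszulFlow hf _ _ _).differentiableAt)
    (fun p => koszulFlow_zero f _ _) (fun p => hasDerivAt_koszulFlow f _ _ x) _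

theorem exists_fderiv_koszulSpray_eq (hf : ∀ x, AnalyticAt ℂ f x)
    (hspan : Submodule.span ℂ (Set.range D) = ⊤) (hD : ∀ i, AffineAlong f (D i)) {x : E}
    (hx : ∃ i, Δ_[D i] f x ≠ 0) {δ : E} (hδ : fderiv ℂ f x δ = 0) :
    ∃ τ, fderiv ℂ (fun t => koszulSpray f D t x) 0 τ = δ := by
  have hdiff (i : ι) : fderiv ℂ f x (D i) = Δ_[D i] f x :=
    (hD i).fderiv_apply (hf x).differentiableAt
  obtain ⟨i₀, hi₀⟩ := hx
  obtain ⟨τ, hτ⟩ := exists_sum_smul_koszul_eq hspan (fderiv ℂ f x).toLinearMap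
    (by simpa only [ContinuousLinearMap.coe_coe, hdiff] using hi₀) hδ
  refine ⟨τ, ?_⟩
  rw [(hasFDerivAt_koszulSpray hf D x).fderiv, ← hτ]
  simp [hdiff]

end

end Koszul

section FiberSpray

open scoped fwdDiff

variable {E F : Type*} [NormedAddCommGroup E] [NormedSpace ℂ E]
  [NormedAddCommGroup F] [NormedSpace ℂ F]

-- If the fibres of `h` over a set are retracts, by `R`, of level sets of the function `f`, then
-- flowing inside the level set and retracting to the fibre is a spray.
theorem IsHolomorphicSubmersion.admitsDominatingFiberSpray_of_retraction {ι : Type*} [Finite ι]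
    {h : E → F} {Z : Set E} {X : Set F} (hh : IsHolomorphicSubmersion h Z X) {W : Set E}
    (hWZ : W ⊆ Z) {f : E → ℂ} (hf : ∀ x, AnalyticAt ℂ f x) {D : ι → E}
    (hspan : Submodule.span ℂ (Set.range D) = ⊤) (hD : ∀ i, AffineAlong f (D i)) {R : F → E → E}
    (hR : ∀ z ∈ W, ∀ x, AnalyticAt ℂ (fun p : F × E => R p.1 p.2) (h z, x))
    (hne : ∀ z ∈ W, ∃ i, Δ_[D i] f z ≠ 0)
    (hfiber : ∀ z ∈ W, ∀ x, f x = f z → (∃ i, Δ_[D i] f x ≠ 0) →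
      R (h z) x ∈ Z ∧ h (R (h z) x) = h z)
    (hid : ∀ z ∈ W, ∀ x ∈ Z, h x = h z → f x = f z ∧ R (h z) x = x) :
    AdmitsDominatingFiberSpray h Z W := by
  cases nonempty_fintype ι
  have hana (z : E) (hz : z ∈ W) : AnalyticAt ℂ h z := hh.holomorphic z (hWZ hz)
  refine admitsDominatingFiberSpray_of_holomorphic_family
    (fun z t => R (h z) (koszulSpray f D t z)) (fun z hz t => ?_)
    (fun z hz => (hana z hz).differentiableAt)
    (fun z hz t => hfiber z hz _ (apply_koszulSpray hD t z)
      (exists_fwdDiff_koszulSpray_ne hD t (hne z hz)))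
    (fun z hz => ?_) (fun z hz δ hδ => ?_)
  · exact AnalyticAt.fun_comp (g := fun q : F × E => R q.1 q.2)
      (f := fun p : E × (ι × ι → ℂ) => (h p.1, koszulSpray f D p.2 p.1)) (hR z hz _)
      (((hana z hz).fun_comp analyticAt_fst).prod (analyticAt_koszulSpray hf D (z, t)))
  · rw [koszulSpray_zero]
    exact (hid z hz z (hWZ hz) rfl).2
  · have hRz : DifferentiableAt ℂ (R (h z)) z :=
      (AnalyticAt.fun_comp (g := fun p : F × E => R p.1 p.2) (hR z hz z)
        (analyticAt_const.prod analyticAt_id)).differentiableAt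
    have hfδ : fderiv ℂ f z δ = 0 := by
      rw [hh.fderiv_eq_of_eqOn_fiber (hWZ hz) (hf z).differentiableAt
        (differentiableAt_const (f z)) (fun x hx => (hid z hz x hx.1 hx.2).1) hδ,
        fderiv_const_apply, zero_apply]
    have hRδ : fderiv ℂ (R (h z)) z δ = δ := by
      rw [hh.fderiv_eq_of_eqOn_fiber (hWZ hz) hRz differentiableAt_id
        (fun x hx => (hid z hz x hx.1 hx.2).2) hδ, fderiv_id, ContinuousLinearMap.id_apply]
    obtain ⟨τ, hτ⟩ := exists_fderiv_koszulSpray_eq hf hspan hD (hne z hz) hfδ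
    have hcomp : HasFDerivAt (fun t => R (h z) (koszulSpray f D t z)) _ 0 :=
      HasFDerivAt.comp (0 : ι × ι → ℂ) (f := fun t => koszulSpray f D t z)
        (by simpa only [koszulSpray_zero] using hRz.hasFDerivAt)
        (hasFDerivAt_koszulSpray hf D z).differentiableAt.hasFDerivAt
    refine ⟨τ, ?_⟩
    rw [hcomp.fderiv, ContinuousLinearMap.comp_apply, hτ, hRδ]

end FiberSpray

/-! ### Unitriangular matrices -/

section Unitriangular

variable {ι α R : Type*} [LinearOrder α] [CommRing R]

/-- `M` is upper triangular with diagonal entries `1`, for the preorder of the indices given by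
the rank function `b`. -/
def IsUnitriangular (b : ι → α) (M : Matrix ι ι R) : Prop :=
  M.BlockTriangular b ∧ ∀ i, M i i = 1

variable {b : ι → α} {M N : Matrix ι ι R}

theorem isUnitriangular_one_add [DecidableEq ι] {X : Matrix ι ι R}
    (hX : ∀ i j, b j ≤ b i → X i j = 0) : IsUnitriangular b (1 + X) :=
  ⟨Matrix.blockTriangular_one.add fun i j hij => hX i j hij.le, fun i => by
    rw [Matrix.add_apply, Matrix.one_apply_eq, hX i i le_rfl, add_zero]⟩

theorem isUnitriangular_one [DecidableEq ι] : IsUnitriangular b (1 : Matrix ι ι R) :=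
  ⟨Matrix.blockTriangular_one, Matrix.one_apply_eq⟩

namespace IsUnitriangular

theorem submatrix (hM : IsUnitriangular b M) {κ : Type*} (e : κ → ι) :
    IsUnitriangular (b ∘ e) (M.submatrix e e) :=
  ⟨hM.1.submatrix, fun i => hM.2 (e i)⟩

variable [Fintype ι]

section VecMul

variable {u : ι → R} {d : ι} (hM : IsUnitriangular b M) (hu : ∀ l, b l < b d → u l = 0)
include hM hu

theorem vecMul_apply_of_lt {l : ι} (hl : b l < b d) : (u ᵥ* M) l = 0 := by
  rw [Matrix.vecMul, dotProduct]
  refine Finset.sum_eq_zero fun k _ => ?_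
  rcases lt_or_ge (b k) (b d) with hk | hk
  · rw [hu k hk, zero_mul]
  · rw [hM.1 (hl.trans_le hk), mul_zero]

theorem vecMul_apply_pivot (hb : Function.Injective b) : (u ᵥ* M) d = u d := by
  rw [Matrix.vecMul, dotProduct, Finset.sum_eq_single d _ (by simp), hM.2, mul_one]
  intro k _ hk
  rcases lt_or_gt_of_ne (hb.ne hk) with hlt | hgt
  · rw [hu k hlt, zero_mul]
  · rw [hM.1 hgt, mul_zero]

end VecMul

theorem mul (hb : Function.Injective b) (hM : IsUnitriangular b M) (hN : IsUnitriangular b N) :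
    IsUnitriangular b (M * N) :=
  ⟨hM.1.mul hN.1, fun i => by
    rw [Matrix.mul_apply_eq_vecMul, hN.vecMul_apply_pivot (fun _ hl => hM.1 hl) hb, hM.2]⟩

variable [DecidableEq ι]

theorem det_eq_one (hb : Function.Injective b) (hM : IsUnitriangular b M) : M.det = 1 := by
  rw [hM.1.det]
  refine Finset.prod_eq_one fun k _ => ?_
  have hblock : M.toSquareBlock b k = 1 := by
    ext ⟨i, hi⟩ ⟨j, hj⟩
    obtain rfl : i = j := hb (hi.trans hj.symm)
    rw [Matrix.one_apply_eq]
    exact hM.2 i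
  rw [hblock, Matrix.det_one]

theorem isUnit_det (hb : Function.Injective b) (hM : IsUnitriangular b M) : IsUnit M.det :=
  hM.det_eq_one hb ▸ isUnit_one

theorem inv (hb : Function.Injective b) (hM : IsUnitriangular b M) : IsUnitriangular b M⁻¹ := by
  have : Invertible M := M.invertibleOfIsUnitDet (hM.isUnit_det hb)
  have htri : M⁻¹.BlockTriangular b := Matrix.blockTriangular_inv_of_blockTriangular hM.1
  refine ⟨htri, fun i => ?_⟩
  rw [← hM.vecMul_apply_pivot (u := M⁻¹ i) (fun _ hl => htri hl) hb,
    ← Matrix.mul_apply_eq_vecMul, Matrix.inv_mul_of_invertible, Matrix.one_apply_eq]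

end IsUnitriangular

end Unitriangular

/-! ### Coordinates of the factors -/

section Coordinates

variable {n : ℕ}

/-- The entries above the diagonal. -/
def triCoord (A : Matrix (Fin n) (Fin n) ℂ) : UnitriCoord n := fun p => A p.1.1 p.1.2

/-- The coordinates of the symmetric part of a matrix. -/
noncomputable def symCoord (B : Matrix (Fin n) (Fin n) ℂ) : SymCoord n :=
  Sym2.lift ⟨fun i j => (B i j + B j i) / 2, fun i j => congrArg (· / 2) (add_comm (B i j) (B j i))⟩

theorem isUnitriangular_unitriMatrix (a : UnitriCoord n) :
    IsUnitriangular id (unitriMatrix a) := by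
  refine ⟨fun i j (hij : j < i) => ?_, fun i => ?_⟩
  · simp [unitriMatrix, hij.not_gt, hij.ne']
  · simp [unitriMatrix]

theorem unitriMatrix_triCoord {A : Matrix (Fin n) (Fin n) ℂ} (hA : IsUnitriangular id A) :
    unitriMatrix (triCoord A) = A := by
  ext i j
  rcases lt_trichotomy i j with hij | rfl | hij
  · simp [unitriMatrix, triCoord, hij]
  · simp [unitriMatrix, hA.2]
  · simp [unitriMatrix, hij.not_gt, hij.ne', hA.1 hij]

theorem triCoord_unitriMatrix (a : UnitriCoord n) : triCoord (unitriMatrix a) = a := by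
  ext ⟨⟨i, j⟩, hij⟩
  exact dif_pos hij

theorem symMatrix_transpose (z : SymCoord n) : (symMatrix z)ᵀ = symMatrix z := by
  ext i j
  simp [symMatrix, Sym2.eq_swap]

theorem symMatrix_symCoord {B : Matrix (Fin n) (Fin n) ℂ} (hB : Bᵀ = B) :
    symMatrix (symCoord B) = B := by
  ext i j
  have hBij : B j i = B i j := congrFun (congrFun hB i) j
  simp [symMatrix, symCoord, hBij]

theorem symCoord_symMatrix (z : SymCoord n) : symCoord (symMatrix z) = z := by
  ext w
  induction w with
  | _ i j =>
    have hz : z s(j, i) = z s(i, j) := by rw [Sym2.eq_swap]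
    simp [symMatrix, symCoord, hz]

theorem elemMinus_eq (A Z : Matrix (Fin n) (Fin n) ℂ) :
    elemMinus A Z = Matrix.fromBlocks (A⁻¹)ᵀ 0 (Z * (A⁻¹)ᵀ) A := by
  simp [elemMinus, Matrix.fromBlocks_multiply]

theorem elemPlus_eq (A Z : Matrix (Fin n) (Fin n) ℂ) :
    elemPlus A Z = Matrix.fromBlocks A⁻¹ (Z * Aᵀ) 0 Aᵀ := by
  simp [elemPlus, Matrix.fromBlocks_multiply]

theorem elemPlus_eq_submatrix {A : Matrix (Fin n) (Fin n) ℂ} (hA : IsUnit A.det)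
    (Z : Matrix (Fin n) (Fin n) ℂ) :
    elemPlus A Z = (elemMinus A⁻¹ Z).submatrix Sum.swap Sum.swap := by
  rw [elemPlus_eq, elemMinus_eq, Matrix.nonsing_inv_nonsing_inv _ hA]
  ext (i | i) (j | j) <;> rfl

theorem elemMinus_mul {A : Matrix (Fin n) (Fin n) ℂ} (hA : IsUnit A.det)
    (C Z W : Matrix (Fin n) (Fin n) ℂ) :
    elemMinus A Z * elemMinus C W = elemMinus (A * C) (Z + A * W * Aᵀ) := by
  have hAA : Aᵀ * (A⁻¹)ᵀ = 1 := by
    rw [← Matrix.transpose_mul, Matrix.nonsing_inv_mul _ hA, Matrix.transpose_one]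
  simp only [elemMinus_eq, Matrix.fromBlocks_multiply, Matrix.mul_inv_rev, Matrix.transpose_mul,
    zero_mul, mul_zero, add_zero, zero_add]
  rw [add_mul, Matrix.mul_assoc Z, Matrix.mul_assoc (A * W), ← Matrix.mul_assoc Aᵀ, hAA,
    Matrix.one_mul, Matrix.mul_assoc A W]

theorem elemMinus_one_add_smul {X S : Matrix (Fin n) (Fin n) ℂ} (hX : X * X = 0)
    (hS : S * Xᵀ = 0) (t : ℂ) :
    elemMinus (1 + t • X) (t • S) = 1 + t • Matrix.fromBlocks (-Xᵀ) 0 S X := by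
  have hinv : (1 + t • X)⁻¹ = 1 - t • X := Matrix.inv_eq_right_inv <| by
    simp [add_mul, mul_sub, hX]
  have hblock : t • S * (1 - t • X)ᵀ = t • S := by simp [mul_sub, hS]
  rw [elemMinus_eq, hinv, hblock, ← Matrix.fromBlocks_one, Matrix.fromBlocks_smul,
    Matrix.fromBlocks_add]
  simp [sub_eq_add_neg]

end Coordinates

/-! ### Holomorphic matrix functions -/

section EntryAnalytic

variable {G : Type*} [NormedAddCommGroup G] [NormedSpace ℂ G] {l m k : Type*} {x : G}

/-- All entries of the matrix function `f` are holomorphic at `x`. (No norm on the space of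
matrices is needed for this.) -/
def EntryAnalytic (f : G → Matrix l m ℂ) (x : G) : Prop :=
  ∀ i j, AnalyticAt ℂ (fun g => f g i j) x

namespace EntryAnalytic

theorem const (A : Matrix l m ℂ) (x : G) : EntryAnalytic (fun _ => A) x :=
  fun _ _ => analyticAt_const

theorem add {f g : G → Matrix l m ℂ} (hf : EntryAnalytic f x) (hg : EntryAnalytic g x) :
    EntryAnalytic (fun y => f y + g y) x :=
  fun i j => (hf i j).add (hg i j)

theorem sub {f g : G → Matrix l m ℂ} (hf : EntryAnalytic f x) (hg : EntryAnalytic g x) :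
    EntryAnalytic (fun y => f y - g y) x :=
  fun i j => (hf i j).sub (hg i j)

theorem smul {f : G → Matrix l m ℂ} {c : G → ℂ} (hc : AnalyticAt ℂ c x)
    (hf : EntryAnalytic f x) : EntryAnalytic (fun y => c y • f y) x :=
  fun i j => hc.mul (hf i j)

theorem transpose {f : G → Matrix l m ℂ} (hf : EntryAnalytic f x) :
    EntryAnalytic (fun y => (f y)ᵀ) x :=
  fun i j => hf j i

theorem vecMulVec {a : G → l → ℂ} {b : G → m → ℂ} (ha : ∀ i, AnalyticAt ℂ (fun y => a y i) x)
    (hb : ∀ j, AnalyticAt ℂ (fun y => b y j) x) :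
    EntryAnalytic (fun y => Matrix.vecMulVec (a y) (b y)) x :=
  fun i j => (ha i).mul (hb j)

theorem mul [Fintype m] {f : G → Matrix l m ℂ} {g : G → Matrix m k ℂ}
    (hf : EntryAnalytic f x) (hg : EntryAnalytic g x) : EntryAnalytic (fun y => f y * g y) x :=
  fun i j => Finset.analyticAt_fun_sum _ fun a _ => (hf i a).mul (hg a j)

theorem vecMul [Fintype m] {u : G → m → ℂ} {g : G → Matrix m k ℂ}
    (hu : ∀ i, AnalyticAt ℂ (fun y => u y i) x) (hg : EntryAnalytic g x) (j : k) :
    AnalyticAt ℂ (fun y => (u y ᵥ* g y) j) x :=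
  Finset.analyticAt_fun_sum _ fun a _ => (hu a).mul (hg a j)

theorem det [Fintype m] [DecidableEq m] {f : G → Matrix m m ℂ} (hf : EntryAnalytic f x) :
    AnalyticAt ℂ (fun y => (f y).det) x := by
  simp only [Matrix.det_apply']
  exact Finset.analyticAt_fun_sum _ fun σ _ =>
    analyticAt_const.mul (Finset.analyticAt_fun_prod _ fun a _ => hf _ _)

theorem inv [Fintype m] [DecidableEq m] {f : G → Matrix m m ℂ} (hf : EntryAnalytic f x)
    (hx : IsUnit (f x).det) : EntryAnalytic (fun y => (f y)⁻¹) x := by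
  intro i j
  simp only [Matrix.inv_def, Ring.inverse_eq_inv', Matrix.smul_apply, smul_eq_mul,
    Matrix.adjugate_apply]
  refine (hf.det.inv hx.ne_zero).mul (EntryAnalytic.det fun a b => ?_)
  by_cases haj : a = j
  · subst haj; simp only [Matrix.updateRow_self]; exact analyticAt_const
  · simp only [Matrix.updateRow_ne haj]; exact hf a b

theorem fromBlocks {l' m' : Type*} {a : G → Matrix l m ℂ} {b : G → Matrix l m' ℂ}
    {c : G → Matrix l' m ℂ} {d : G → Matrix l' m' ℂ} (ha : EntryAnalytic a x)
    (hb : EntryAnalytic b x) (hc : EntryAnalytic c x) (hd : EntryAnalytic d x) :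
    EntryAnalytic (fun y => Matrix.fromBlocks (a y) (b y) (c y) (d y)) x := by
  rintro (i | i) (j | j)
  exacts [ha i j, hb i j, hc i j, hd i j]

variable {n : ℕ}

theorem unitriMatrix {a : G → UnitriCoord n} (ha : AnalyticAt ℂ a x) :
    EntryAnalytic (fun y => unitriMatrix (a y)) x := by
  intro i j
  by_cases hij : i < j
  · simp only [_root_.unitriMatrix, Matrix.of_apply, hij, dite_true]
    exact analyticAt_pi_iff.1 ha _
  · simp only [_root_.unitriMatrix, Matrix.of_apply, hij, dite_false]
    exact analyticAt_const

theorem symMatrix {z : G → SymCoord n} (hz : AnalyticAt ℂ z x) :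
    EntryAnalytic (fun y => symMatrix (z y)) x :=
  fun _ _ => analyticAt_pi_iff.1 hz _

theorem triCoord {f : G → Matrix (Fin n) (Fin n) ℂ} (hf : EntryAnalytic f x) :
    AnalyticAt ℂ (fun y => triCoord (f y)) x :=
  analyticAt_pi_iff.2 fun _ => hf _ _

theorem symCoord {f : G → Matrix (Fin n) (Fin n) ℂ} (hf : EntryAnalytic f x) :
    AnalyticAt ℂ (fun y => symCoord (f y)) x := by
  refine analyticAt_pi_iff.2 fun w => ?_
  induction w with
  | _ i j => exact ((hf i j).add (hf j i)).mul analyticAt_const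

theorem elemMinus {A Z : G → Matrix (Fin n) (Fin n) ℂ} (hA : EntryAnalytic A x)
    (hAx : IsUnit (A x).det) (hZ : EntryAnalytic Z x) :
    EntryAnalytic (fun g => elemMinus (A g) (Z g)) x := by
  simp only [elemMinus_eq]
  have hinv := (hA.inv hAx).transpose
  exact fromBlocks hinv (const 0 x) (hZ.mul hinv) hA

end EntryAnalytic

end EntryAnalytic

/-! ### Moving the coordinates behind the pivot -/

section Pivot

variable {n : ℕ}

/-- The rank of a coordinate in the order `q₁, …, qₙ, pₙ, …, p₁` of the coordinates of
`(p, q) ∈ ℂⁿ × ℂⁿ`, for which the factors `M⁻` are unitriangular. -/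
def pivotRank : Fin n ⊕ Fin n → ℕ
  | Sum.inr i => i
  | Sum.inl j => 2 * n - 1 - j

theorem pivotRank_injective : Function.Injective (pivotRank : Fin n ⊕ Fin n → ℕ) := by
  rintro (i | i) (j | j) hij <;> simp only [pivotRank] at hij
  · congr 1; ext; omega
  · omega
  · omega
  · congr 1; ext; omega

theorem pivotRank_swap (l : Fin n ⊕ Fin n) : pivotRank l.swap = 2 * n - 1 - pivotRank l := by
  rcases l with i | i <;> simp only [pivotRank, Sum.swap_inl, Sum.swap_inr]
  omega

theorem pivotRank_lt (l : Fin n ⊕ Fin n) : pivotRank l < 2 * n := by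
  rcases l with i | i <;> simp only [pivotRank] <;> omega

theorem isUnitriangular_elemMinus {A : Matrix (Fin n) (Fin n) ℂ} (hA : IsUnitriangular id A)
    (Z : Matrix (Fin n) (Fin n) ℂ) : IsUnitriangular pivotRank (elemMinus A Z) := by
  have hinv := hA.inv Function.injective_id
  rw [elemMinus_eq]
  constructor
  · rintro (i | i) (j | j) hij <;> simp only [pivotRank] at hij
    · exact hinv.1 (show i < j by omega)
    · rfl
    · omega
    · exact hA.1 (show j < i by omega)
  · rintro (i | i)
    exacts [hinv.2 i, hA.2 i]

/-- The multiples of the coordinate `d` that have to be added to the coordinates of `u` behind `d`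
in order to obtain those of `v`, if `u d = v d`. -/
noncomputable def pivotGap (d : Fin n ⊕ Fin n) (u v : Fin n ⊕ Fin n → ℂ) (l : Fin n ⊕ Fin n) : ℂ :=
  if pivotRank d < pivotRank l then (v l - u l) / v d else 0

/-- The unitriangular part of the factor `M⁻` that moves the coordinates of `u` behind the pivot
`d` to those of `v`, if `u d = v d ≠ 0`. -/
noncomputable def pivotTri (d : Fin n ⊕ Fin n) (u v : Fin n ⊕ Fin n → ℂ) :
    Matrix (Fin n) (Fin n) ℂ :=
  match d with
  | Sum.inr i => 1 + Matrix.vecMulVec (Pi.single i 1) (pivotGap d u v ∘ Sum.inr)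
  | Sum.inl j => (1 + Matrix.vecMulVec (pivotGap d u v ∘ Sum.inl) (Pi.single j 1))⁻¹

/-- The value that the row `q = (u (Sum.inr k))ₖ` times the symmetric part `pivotSym` has to take
for a pivot among the coordinates of `q`. -/
noncomputable def pivotRhs (i : Fin n) (u v : Fin n ⊕ Fin n → ℂ) : Fin n → ℂ :=
  (v ∘ Sum.inl) ᵥ* (pivotTri (Sum.inr i) u v)ᵀ - u ∘ Sum.inl

/-- The symmetric part of the factor `M⁻` that moves the coordinates of `u` behind the pivot `d` to
those of `v`, if `u d = v d ≠ 0`. For `q i ≠ 0`, the equation `q W = b` has the symmetric solution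
`W = qᵢ⁻¹ (b eᵢᵀ + eᵢ bᵀ) - qᵢ⁻² (q · b) eᵢ eᵢᵀ`. -/
noncomputable def pivotSym (d : Fin n ⊕ Fin n) (u v : Fin n ⊕ Fin n → ℂ) :
    Matrix (Fin n) (Fin n) ℂ :=
  match d with
  | Sum.inr i =>
      (v (Sum.inr i))⁻¹ • (Matrix.vecMulVec (pivotRhs i u v) (Pi.single i 1) +
        Matrix.vecMulVec (Pi.single i 1) (pivotRhs i u v)) -
      ((v (Sum.inr i))⁻¹ * (v (Sum.inr i))⁻¹ * ((u ∘ Sum.inr) ⬝ᵥ pivotRhs i u v)) •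
        Matrix.vecMulVec (Pi.single i 1) (Pi.single i 1)
  | Sum.inl _ => 0

variable (d : Fin n ⊕ Fin n) (u v : Fin n ⊕ Fin n → ℂ)

theorem isUnitriangular_one_add_vecMulVec_inr (i : Fin n) :
    IsUnitriangular id
      (1 + Matrix.vecMulVec (Pi.single i 1) (pivotGap (Sum.inr i) u v ∘ Sum.inr)) := by
  refine isUnitriangular_one_add fun a b (hab : b ≤ a) => ?_
  rcases eq_or_ne a i with rfl | ha
  · simp [Matrix.vecMulVec_apply, pivotGap, pivotRank, hab]
  · simp [Matrix.vecMulVec_apply, ha]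

theorem isUnitriangular_one_add_vecMulVec_inl (j : Fin n) :
    IsUnitriangular id
      (1 + Matrix.vecMulVec (pivotGap (Sum.inl j) u v ∘ Sum.inl) (Pi.single j 1)) := by
  refine isUnitriangular_one_add fun a b (hab : b ≤ a) => ?_
  rcases eq_or_ne b j with rfl | hb
  · have hrank : ¬ 2 * n - 1 - b < 2 * n - 1 - (a : ℕ) := by omega
    simp [Matrix.vecMulVec_apply, pivotGap, pivotRank, hrank]
  · simp [Matrix.vecMulVec_apply, hb]

theorem isUnitriangular_pivotTri : IsUnitriangular id (pivotTri d u v) := by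
  rcases d with j | i
  · exact (isUnitriangular_one_add_vecMulVec_inl u v j).inv Function.injective_id
  · exact isUnitriangular_one_add_vecMulVec_inr u v i

theorem isUnit_det_pivotTri : IsUnit (pivotTri d u v).det :=
  (isUnitriangular_pivotTri d u v).isUnit_det Function.injective_id

theorem pivotTri_inl_inv (j : Fin n) : (pivotTri (Sum.inl j) u v)⁻¹ =
    1 + Matrix.vecMulVec (pivotGap (Sum.inl j) u v ∘ Sum.inl) (Pi.single j 1) :=
  Matrix.nonsing_inv_nonsing_inv _
    ((isUnitriangular_one_add_vecMulVec_inl u v j).isUnit_det Function.injective_id)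

theorem pivotSym_transpose : (pivotSym d u v)ᵀ = pivotSym d u v := by
  rcases d with _ | i
  · exact Matrix.transpose_zero
  · simp only [pivotSym, Matrix.transpose_sub, Matrix.transpose_smul, Matrix.transpose_add,
      Matrix.transpose_vecMulVec]
    rw [add_comm]

theorem elemMinus_pivot_mulVec_single :
    elemMinus (pivotTri d u v) (pivotSym d u v) *ᵥ Pi.single d 1 = Pi.single d 1 := by
  rw [Matrix.mulVec_single_one, elemMinus_eq]
  ext k
  rcases d with j | i
  · rw [pivotTri_inl_inv]
    rcases k with k | k
    · rcases eq_or_ne k j with rfl | hk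
      · simp [Matrix.vecMulVec_apply, pivotGap]
      · simp [Matrix.vecMulVec_apply, hk]
    · simp [pivotSym]
  · rcases k with k | k
    · simp
    · rcases eq_or_ne k i with rfl | hk
      · simp [pivotTri, Matrix.vecMulVec_apply, pivotGap]
      · simp [pivotTri, Matrix.vecMulVec_apply, hk]

variable {d u v}

section Move

variable (hd : v d ≠ 0) (hu : u d = v d)
include hd hu

theorem add_mul_pivotGap {l : Fin n ⊕ Fin n} (hl : pivotRank d < pivotRank l) :
    u l + u d * pivotGap d u v l = v l := by
  rw [pivotGap, if_pos hl, hu, mul_div_cancel₀ _ hd, add_sub_cancel]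

omit hd hu in
theorem vecMul_pivotSym {i : Fin n} (hi : v (Sum.inr i) ≠ 0)
    (hui : u (Sum.inr i) = v (Sum.inr i)) :
    (u ∘ Sum.inr) ᵥ* pivotSym (Sum.inr i) u v = pivotRhs i u v := by
  ext k
  simp only [pivotSym, Matrix.vecMul_sub, Matrix.vecMul_smul, Matrix.vecMul_add,
    Matrix.vecMul_vecMulVec, Pi.sub_apply, Pi.smul_apply, Pi.add_apply, dotProduct_single,
    mul_one, Function.comp_apply, hui, smul_eq_mul]
  field_simp
  ring

theorem vecMul_elemMinus_pivot_apply {l : Fin n ⊕ Fin n} (hl : pivotRank d < pivotRank l) :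
    (u ᵥ* elemMinus (pivotTri d u v) (pivotSym d u v)) l = v l := by
  have hgap := add_mul_pivotGap hd hu hl
  rw [elemMinus_eq, Matrix.vecMul_fromBlocks]
  rcases d with j | i <;> rcases l with k | k
  · rw [pivotTri_inl_inv]
    simpa [pivotSym, Matrix.vecMul_add, Matrix.vecMul_vecMulVec, mul_comm] using hgap
  · simp only [pivotRank] at hl; omega
  · have hinv : (pivotTri (Sum.inr i) u v)ᵀ * ((pivotTri (Sum.inr i) u v)⁻¹)ᵀ = 1 := by
      rw [← Matrix.transpose_mul, Matrix.nonsing_inv_mul _ (isUnit_det_pivotTri _ u v),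
        Matrix.transpose_one]
    rw [Sum.elim_inl, ← Matrix.vecMul_vecMul, vecMul_pivotSym hd hu, ← Matrix.add_vecMul, pivotRhs,
      add_sub_cancel, Matrix.vecMul_vecMul, hinv, Matrix.vecMul_one, Function.comp_apply]
  · simpa [pivotTri, Matrix.vecMul_add, Matrix.vecMul_vecMulVec] using hgap

end Move

section Fixed

variable (h : ∀ l, pivotRank d < pivotRank l → u l = v l)
include h

theorem pivotGap_eq_zero : pivotGap d u v = 0 := by
  ext l
  rw [pivotGap, Pi.zero_apply, ite_eq_right_iff]
  intro hl
  rw [h l hl, sub_self, zero_div]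

theorem pivotTri_eq_one : pivotTri d u v = 1 := by
  rcases d with j | i <;> simp [pivotTri, pivotGap_eq_zero h]

theorem pivotSym_eq_zero : pivotSym d u v = 0 := by
  rcases d with j | i
  · rfl
  · have hrhs : pivotRhs i u v = 0 := by
      ext k
      simp [pivotRhs, pivotTri_eq_one h, h (Sum.inl k) (by simp only [pivotRank]; omega)]
    simp [pivotSym, hrhs]

end Fixed

section Analytic

variable {G : Type*} [NormedAddCommGroup G] [NormedSpace ℂ G]
  {u v : G → Fin n ⊕ Fin n → ℂ} {x : G} (hd : v x d ≠ 0)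
  (hu : ∀ l, AnalyticAt ℂ (fun y => u y l) x) (hv : ∀ l, AnalyticAt ℂ (fun y => v y l) x)
include hd hu hv

theorem analyticAt_pivotGap (l : Fin n ⊕ Fin n) :
    AnalyticAt ℂ (fun y => pivotGap d (u y) (v y) l) x := by
  by_cases hl : pivotRank d < pivotRank l
  · simp only [pivotGap, if_pos hl]
    exact ((hv l).sub (hu l)).div (hv d) hd
  · simp only [pivotGap, if_neg hl]
    exact analyticAt_const

theorem entryAnalytic_pivotTri : EntryAnalytic (fun y => pivotTri d (u y) (v y)) x := by
  have hgap := analyticAt_pivotGap hd hu hv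
  rcases d with j | i
  · simp only [pivotTri]
    refine EntryAnalytic.inv (.add (.const 1 x) (.vecMulVec (fun k => ?_) fun k => ?_))
      ((isUnitriangular_one_add_vecMulVec_inl _ _ j).isUnit_det Function.injective_id)
    exacts [hgap _, analyticAt_const]
  · simp only [pivotTri]
    refine .add (.const 1 x) (.vecMulVec (fun k => ?_) fun k => ?_)
    exacts [analyticAt_const, hgap _]

omit hd in
theorem analyticAt_pivotRhs {i : Fin n} (hi : v x (Sum.inr i) ≠ 0) (k : Fin n) :
    AnalyticAt ℂ (fun y => pivotRhs i (u y) (v y) k) x := by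
  have htri := (entryAnalytic_pivotTri hi hu hv).transpose
  exact (EntryAnalytic.vecMul (fun j => hv (Sum.inl j)) htri k).sub (hu (Sum.inl k))

theorem entryAnalytic_pivotSym : EntryAnalytic (fun y => pivotSym d (u y) (v y)) x := by
  rcases d with j | i
  · exact EntryAnalytic.const 0 x
  · have hrhs := analyticAt_pivotRhs hu hv hd
    have hinv := (hv (Sum.inr i)).inv hd
    have hdot : AnalyticAt ℂ (fun y => (u y ∘ Sum.inr) ⬝ᵥ pivotRhs i (u y) (v y)) x :=
      Finset.analyticAt_fun_sum _ fun k _ => (hu (Sum.inr k)).mul (hrhs k)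
    simp only [pivotSym]
    refine .sub (.smul hinv (.add (.vecMulVec hrhs fun k => ?_) (.vecMulVec (fun k => ?_) hrhs)))
      (.smul ((hinv.mul hinv).mul hdot) (.const _ x))
    exacts [analyticAt_const, analyticAt_const]

end Analytic

end Pivot

/-! ### The factors of both signs -/

section Step

variable {n : ℕ}

/-- The identity for the factors `M⁻` (`true`), and the exchange of the two halves of the
coordinates, which turns a factor `M⁺` into a factor `M⁻`, for the factors `M⁺` (`false`). -/
def signSwap : Bool → (Fin n ⊕ Fin n ≃ Fin n ⊕ Fin n)
  | true => Equiv.refl _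
  | false => Equiv.sumComm _ _

theorem signSwap_symm (s : Bool) :
    (signSwap s : Fin n ⊕ Fin n ≃ Fin n ⊕ Fin n).symm = signSwap s := by
  cases s <;> rfl

theorem signSwap_signSwap (s : Bool) (l : Fin n ⊕ Fin n) : signSwap s (signSwap s l) = l := by
  cases s
  exacts [Sum.swap_swap l, rfl]

/-- Conjugation by the coordinate permutation `signSwap s`. -/
def signConj (s : Bool) (M : Matrix (Fin n ⊕ Fin n) (Fin n ⊕ Fin n) ℂ) :
    Matrix (Fin n ⊕ Fin n) (Fin n ⊕ Fin n) ℂ :=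
  M.submatrix (signSwap s) (signSwap s)

section SignConj

variable (s : Bool) (M N : Matrix (Fin n ⊕ Fin n) (Fin n ⊕ Fin n) ℂ) (u : Fin n ⊕ Fin n → ℂ)

theorem signConj_mul : signConj s (M * N) = signConj s M * signConj s N :=
  (Matrix.submatrix_mul_equiv M N _ _ _).symm

theorem vecMul_signConj : u ᵥ* signConj s M = ((u ∘ signSwap s) ᵥ* M) ∘ signSwap s := by
  rw [signConj, Matrix.submatrix_vecMul_equiv, signSwap_symm]

theorem signConj_mulVec : signConj s M *ᵥ u = (M *ᵥ (u ∘ signSwap s)) ∘ signSwap s := by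
  rw [signConj, Matrix.submatrix_mulVec_equiv, signSwap_symm]

end SignConj

/-- The rank of a coordinate in the order for which the factors of sign `s` are unitriangular. -/
def signRank (s : Bool) (l : Fin n ⊕ Fin n) : ℕ := pivotRank (signSwap s l)

theorem signRank_signSwap (s : Bool) (l : Fin n ⊕ Fin n) :
    signRank s (signSwap s l) = pivotRank l := by
  rw [signRank, signSwap_signSwap]

theorem signRank_injective (s : Bool) : Function.Injective (signRank s : Fin n ⊕ Fin n → ℕ) :=
  pivotRank_injective.comp (signSwap s).injective

theorem signRank_not (s : Bool) (l : Fin n ⊕ Fin n) :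
    signRank (!s) l = 2 * n - 1 - signRank s l := by
  cases s
  · exact (congrArg pivotRank (Sum.swap_swap l)).symm.trans (pivotRank_swap l.swap)
  · exact pivotRank_swap l

theorem signRank_not_lt_iff (s : Bool) {l k : Fin n ⊕ Fin n} :
    signRank (!s) l < signRank (!s) k ↔ signRank s k < signRank s l := by
  have hl : signRank s l < 2 * n := pivotRank_lt _
  have hk : signRank s k < 2 * n := pivotRank_lt _
  rw [signRank_not, signRank_not]
  omega

/-- The factor `M⁻` (for `true`) or `M⁺` (for `false`). -/
noncomputable def stepMat : Bool → UnitriCoord n × SymCoord n →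
    Matrix (Fin n ⊕ Fin n) (Fin n ⊕ Fin n) ℂ
  | true, y => elemMinus (unitriMatrix y.1) (symMatrix y.2)
  | false, y => elemPlus (unitriMatrix y.1) (symMatrix y.2)

/-- The unitriangular matrix of a factor, inverted for the factors `M⁺`. -/
noncomputable def stepTri : Bool → UnitriCoord n × SymCoord n → Matrix (Fin n) (Fin n) ℂ
  | true, y => unitriMatrix y.1
  | false, y => (unitriMatrix y.1)⁻¹

/-- The coordinates of the factor of sign `s` with given `stepTri` and symmetric matrix. -/
noncomputable def stepCoord : Bool → Matrix (Fin n) (Fin n) ℂ → Matrix (Fin n) (Fin n) ℂ →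
    UnitriCoord n × SymCoord n
  | true, A, Z => (triCoord A, symCoord Z)
  | false, A, Z => (triCoord A⁻¹, symCoord Z)

variable (s : Bool) (y : UnitriCoord n × SymCoord n)

theorem isUnitriangular_stepTri : IsUnitriangular id (stepTri s y) := by
  cases s
  exacts [(isUnitriangular_unitriMatrix y.1).inv Function.injective_id,
    isUnitriangular_unitriMatrix y.1]

theorem isUnit_det_stepTri : IsUnit (stepTri s y).det :=
  (isUnitriangular_stepTri s y).isUnit_det Function.injective_id

theorem stepMat_eq : stepMat s y = signConj s (elemMinus (stepTri s y) (symMatrix y.2)) := by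
  cases s
  exacts [elemPlus_eq_submatrix (isUnit_det_stepTri true y) _, rfl]

theorem isUnitriangular_stepMat : IsUnitriangular (signRank s) (stepMat s y) := by
  rw [stepMat_eq]
  exact (isUnitriangular_elemMinus (isUnitriangular_stepTri s y) _).submatrix (signSwap s)

theorem isUnit_det_stepMat : IsUnit (stepMat s y).det :=
  (isUnitriangular_stepMat s y).isUnit_det (signRank_injective s)

theorem isUnitriangular_stepMat_inv : IsUnitriangular (signRank s) (stepMat s y)⁻¹ :=
  (isUnitriangular_stepMat s y).inv (signRank_injective s)

theorem stepMat_stepCoord {A Z : Matrix (Fin n) (Fin n) ℂ} (hA : IsUnitriangular id A)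
    (hZ : Zᵀ = Z) : stepMat s (stepCoord s A Z) = signConj s (elemMinus A Z) := by
  have hinv := hA.inv Function.injective_id
  have hdet := hA.isUnit_det Function.injective_id
  rw [stepMat_eq]
  cases s <;> simp only [stepCoord, stepTri, unitriMatrix_triCoord hA, unitriMatrix_triCoord hinv,
    symMatrix_symCoord hZ, Matrix.nonsing_inv_nonsing_inv _ hdet]

theorem stepCoord_stepTri : stepCoord s (stepTri s y) (symMatrix y.2) = y := by
  have hdet := (isUnitriangular_unitriMatrix y.1).isUnit_det Function.injective_id
  cases s <;> simp only [stepCoord, stepTri, symCoord_symMatrix, triCoord_unitriMatrix,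
    Matrix.nonsing_inv_nonsing_inv _ hdet]

/-- The coordinates of the product of the factor with coordinates `y` and of `M⁻(C, W)`,
transferred to the sign `s`. -/
noncomputable def stepMulElem (C W : Matrix (Fin n) (Fin n) ℂ) : UnitriCoord n × SymCoord n :=
  stepCoord s (stepTri s y * C) (symMatrix y.2 + stepTri s y * W * (stepTri s y)ᵀ)

/-- The coordinates of the product of `M⁻(C, W)`, transferred to the sign `s`, and of the factor
with coordinates `y`. -/
noncomputable def elemMulStep (C W : Matrix (Fin n) (Fin n) ℂ) : UnitriCoord n × SymCoord n :=
  stepCoord s (C * stepTri s y) (W + C * symMatrix y.2 * Cᵀ)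

section Product

variable {C W : Matrix (Fin n) (Fin n) ℂ} (hC : IsUnitriangular id C) (hW : Wᵀ = W)
include hC hW

theorem stepMat_stepMulElem :
    stepMat s (stepMulElem s y C W) = stepMat s y * signConj s (elemMinus C W) := by
  have hA := isUnitriangular_stepTri s y
  have hsymm : (symMatrix y.2 + stepTri s y * W * (stepTri s y)ᵀ)ᵀ =
      symMatrix y.2 + stepTri s y * W * (stepTri s y)ᵀ := by
    simp only [Matrix.transpose_add, Matrix.transpose_mul, Matrix.transpose_transpose,
      symMatrix_transpose, hW, Matrix.mul_assoc]
  rw [stepMulElem, stepMat_stepCoord s (hA.mul Function.injective_id hC) hsymm, stepMat_eq,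
    ← signConj_mul, elemMinus_mul (isUnit_det_stepTri s y)]

theorem stepMat_elemMulStep :
    stepMat s (elemMulStep s y C W) = signConj s (elemMinus C W) * stepMat s y := by
  have hsymm : (W + C * symMatrix y.2 * Cᵀ)ᵀ = W + C * symMatrix y.2 * Cᵀ := by
    simp only [Matrix.transpose_add, Matrix.transpose_mul, Matrix.transpose_transpose,
      symMatrix_transpose, hW, Matrix.mul_assoc]
  rw [elemMulStep, stepMat_stepCoord s (hC.mul Function.injective_id
    (isUnitriangular_stepTri s y)) hsymm, stepMat_eq, ← signConj_mul,
    elemMinus_mul (hC.isUnit_det Function.injective_id)]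

end Product

section Analytic

variable {G : Type*} [NormedAddCommGroup G] [NormedSpace ℂ G] {x : G}
  {y : G → UnitriCoord n × SymCoord n} {C W : G → Matrix (Fin n) (Fin n) ℂ}

theorem analyticAt_stepCoord (hC : EntryAnalytic C x) (hCx : IsUnit (C x).det)
    (hW : EntryAnalytic W x) : AnalyticAt ℂ (fun g => stepCoord s (C g) (W g)) x := by
  cases s
  exacts [(hC.inv hCx).triCoord.prod hW.symCoord, hC.triCoord.prod hW.symCoord]

variable (hy : AnalyticAt ℂ y x)
include hy

theorem entryAnalytic_stepTri : EntryAnalytic (fun g => stepTri s (y g)) x := by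
  have htri : EntryAnalytic (fun g => unitriMatrix (y g).1) x :=
    .unitriMatrix (analyticAt_fst.fun_comp hy)
  cases s
  exacts [htri.inv (isUnit_det_stepTri true (y x)), htri]

theorem entryAnalytic_symMatrix_snd : EntryAnalytic (fun g => symMatrix (y g).2) x :=
  .symMatrix (analyticAt_snd.fun_comp hy)

theorem entryAnalytic_stepMat : EntryAnalytic (fun g => stepMat s (y g)) x := by
  simp only [stepMat_eq]
  exact fun i j => EntryAnalytic.elemMinus (entryAnalytic_stepTri s hy)
    (isUnit_det_stepTri s _) (entryAnalytic_symMatrix_snd hy) _ _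

variable (hC : EntryAnalytic C x) (hCx : IsUnit (C x).det) (hW : EntryAnalytic W x)
include hC hCx hW

theorem analyticAt_stepMulElem :
    AnalyticAt ℂ (fun g => stepMulElem s (y g) (C g) (W g)) x := by
  have hA := entryAnalytic_stepTri s hy
  refine analyticAt_stepCoord s (hA.mul hC) ?_
    (.add (entryAnalytic_symMatrix_snd hy) ((hA.mul hW).mul hA.transpose))
  rw [Matrix.det_mul]
  exact (isUnit_det_stepTri s _).mul hCx

theorem analyticAt_elemMulStep :
    AnalyticAt ℂ (fun g => elemMulStep s (y g) (C g) (W g)) x := by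
  refine analyticAt_stepCoord s (hC.mul (entryAnalytic_stepTri s hy)) ?_
    (hW.add ((hC.mul (entryAnalytic_symMatrix_snd hy)).mul hC.transpose))
  rw [Matrix.det_mul]
  exact hCx.mul (isUnit_det_stepTri s _)

end Analytic

/-- The change of the factor with coordinates `y` that moves the coordinates behind the pivot `d`
of a row `u` with `u d = v d`, the product of some row and the factor, to those of `v`. -/
noncomputable def stepAdjust (d : Fin n ⊕ Fin n) (u v : Fin n ⊕ Fin n → ℂ) :
    UnitriCoord n × SymCoord n :=
  stepMulElem s y (pivotTri (signSwap s d) (u ∘ signSwap s) (v ∘ signSwap s))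
    (pivotSym (signSwap s d) (u ∘ signSwap s) (v ∘ signSwap s))

section Adjust

variable (d : Fin n ⊕ Fin n) (u v : Fin n ⊕ Fin n → ℂ)

theorem stepMat_stepAdjust : stepMat s (stepAdjust s y d u v) = stepMat s y *
    signConj s (elemMinus (pivotTri (signSwap s d) (u ∘ signSwap s) (v ∘ signSwap s))
      (pivotSym (signSwap s d) (u ∘ signSwap s) (v ∘ signSwap s))) :=
  stepMat_stepMulElem s y (isUnitriangular_pivotTri _ _ _) (pivotSym_transpose _ _ _)

theorem stepMat_stepAdjust_mulVec_single :
    stepMat s (stepAdjust s y d u v) *ᵥ Pi.single d 1 = stepMat s y *ᵥ Pi.single d 1 := by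
  have hsingle (k : Fin n ⊕ Fin n) :
      (Pi.single k 1 : Fin n ⊕ Fin n → ℂ) ∘ signSwap s = Pi.single (signSwap s k) 1 := by
    rw [Pi.single_comp_equiv, signSwap_symm]
  rw [stepMat_stepAdjust, ← Matrix.mulVec_mulVec, signConj_mulVec, hsingle,
    elemMinus_pivot_mulVec_single, hsingle, signSwap_signSwap]

theorem vecMul_stepAdjust_pivot (r : Fin n ⊕ Fin n → ℂ) :
    (r ᵥ* stepMat s (stepAdjust s y d u v)) d = (r ᵥ* stepMat s y) d := by
  have hcol := congrArg (r ⬝ᵥ ·) (stepMat_stepAdjust_mulVec_single s y d u v)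
  simpa only [Matrix.dotProduct_mulVec, dotProduct_single, mul_one] using hcol

variable {s y d u v}

theorem vecMul_stepAdjust_of_lt {r : Fin n ⊕ Fin n → ℂ} (hr : r ᵥ* stepMat s y = u)
    (hd : v d ≠ 0) (hu : u d = v d) {l : Fin n ⊕ Fin n} (hl : signRank s d < signRank s l) :
    (r ᵥ* stepMat s (stepAdjust s y d u v)) l = v l := by
  rw [stepMat_stepAdjust, ← Matrix.vecMul_vecMul, hr, vecMul_signConj, Function.comp_apply,
    vecMul_elemMinus_pivot_apply (by simpa only [Function.comp_apply, signSwap_signSwap])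
      (by simpa only [Function.comp_apply, signSwap_signSwap]) hl, Function.comp_apply,
    signSwap_signSwap]

theorem stepAdjust_self (h : ∀ l, signRank s d < signRank s l → u l = v l) :
    stepAdjust s y d u v = y := by
  have hswap : ∀ l, pivotRank (signSwap s d) < pivotRank l →
      (u ∘ signSwap s) l = (v ∘ signSwap s) l := fun l hl =>
    h _ (by rwa [signRank_signSwap])
  rw [stepAdjust, stepMulElem, pivotTri_eq_one hswap, pivotSym_eq_zero hswap, mul_one, mul_zero,
    zero_mul, add_zero, stepCoord_stepTri]

theorem analyticAt_stepAdjust {G : Type*} [NormedAddCommGroup G] [NormedSpace ℂ G] {x : G}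
    {u v : G → Fin n ⊕ Fin n → ℂ} {y : G → UnitriCoord n × SymCoord n}
    (hy : AnalyticAt ℂ y x) (hd : v x d ≠ 0) (hu : ∀ l, AnalyticAt ℂ (fun g => u g l) x)
    (hv : ∀ l, AnalyticAt ℂ (fun g => v g l) x) :
    AnalyticAt ℂ (fun g => stepAdjust s (y g) d (u g) (v g)) x := by
  have hd' : (v x ∘ signSwap s) (signSwap s d) ≠ 0 := by
    rwa [Function.comp_apply, signSwap_signSwap]
  exact analyticAt_stepMulElem s hy (entryAnalytic_pivotTri hd' (fun _ => hu _) fun _ => hv _)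
    (isUnit_det_pivotTri _ _ _) (entryAnalytic_pivotSym hd' (fun _ => hu _) fun _ => hv _)

end Adjust

end Step

section Directions

variable {n : ℕ}

/-- The coordinate vectors of the parameter space of one factor. -/
def blockDir : ({p : Fin n × Fin n // p.1 < p.2} ⊕ Sym2 (Fin n)) → UnitriCoord n × SymCoord n
  | Sum.inl p => (Pi.single p 1, 0)
  | Sum.inr w => (0, Pi.single w 1)

theorem span_range_blockDir : Submodule.span ℂ (Set.range (blockDir (n := n))) = ⊤ := by
  rw [eq_top_iff]
  rintro ⟨a, z⟩ -
  have hsum : ((a, z) : UnitriCoord n × SymCoord n) =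
      ∑ p, a p • blockDir (Sum.inl p) + ∑ w, z w • blockDir (Sum.inr w) := by
    refine Prod.ext ?_ ?_ <;> ext k <;>
      simp [blockDir, Prod.fst_sum, Prod.snd_sum, Finset.sum_apply, Pi.single_apply]
  rw [hsum]
  exact Submodule.add_mem _
    (Submodule.sum_mem _ fun p _ => Submodule.smul_mem _ _ (Submodule.subset_span ⟨_, rfl⟩))
    (Submodule.sum_mem _ fun w _ => Submodule.smul_mem _ _ (Submodule.subset_span ⟨_, rfl⟩))

theorem unitriMatrix_add_smul_single (a : UnitriCoord n) (p : {p : Fin n × Fin n // p.1 < p.2})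
    (t : ℂ) : unitriMatrix (a + t • Pi.single p 1) =
      unitriMatrix a + t • Matrix.single p.1.1 p.1.2 1 := by
  obtain ⟨⟨k, l⟩, hkl⟩ := p
  ext i j
  by_cases hij : i < j
  · simp [unitriMatrix, hij, Pi.single_apply, Matrix.single_apply, eq_comm]
  · have hne : ¬(k = i ∧ l = j) := fun e => hij (e.1 ▸ e.2 ▸ hkl)
    simp [unitriMatrix, hij, hne]

variable (s : Bool) (y : UnitriCoord n × SymCoord n)

theorem exists_stepTri_add_smul (p : {p : Fin n × Fin n // p.1 < p.2}) :
    ∃ X, X * X = 0 ∧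
      ∀ t : ℂ, stepTri s (y + t • blockDir (Sum.inl p)) = stepTri s y * (1 + t • X) := by
  have htri (t : ℂ) : stepTri true (y + t • blockDir (Sum.inl p)) =
      stepTri true y + t • Matrix.single p.1.1 p.1.2 1 := unitriMatrix_add_smul_single y.1 p t
  have hdet := isUnit_det_stepTri true y
  set A := stepTri true y
  set E : Matrix (Fin n) (Fin n) ℂ := Matrix.single p.1.1 p.1.2 1
  have hEAE : E * A⁻¹ * E = 0 := by
    rw [Matrix.single_mul_mul_single,
      ((isUnitriangular_stepTri true y).inv Function.injective_id).1 p.2]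
    simp
  cases s
  · refine ⟨-(E * A⁻¹), by rw [neg_mul_neg, ← mul_assoc, hEAE, zero_mul], fun t => ?_⟩
    refine Matrix.inv_eq_right_inv ((congrArg (· * _) (htri t)).trans ?_)
    calc (A + t • E) * (A⁻¹ * (1 + t • -(E * A⁻¹)))
        = A * A⁻¹ + t • (E * A⁻¹) - t • (A * A⁻¹ * (E * A⁻¹)) -
            (t * t) • (E * A⁻¹ * E * A⁻¹) := by
          simp only [mul_assoc, add_mul, mul_add, smul_mul_assoc, mul_smul_comm, smul_neg,
            mul_neg, mul_smul, mul_one, smul_add]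
          abel
      _ = 1 := by rw [hEAE, Matrix.mul_nonsing_inv _ hdet]; simp
  · refine ⟨A⁻¹ * E, by rw [mul_assoc, ← mul_assoc E, hEAE, mul_zero], fun t => ?_⟩
    rw [htri, mul_add, mul_one, mul_smul_comm, Matrix.mul_nonsing_inv_cancel_left _ _ hdet]

theorem exists_stepMat_add_smul (b : {p : Fin n × Fin n // p.1 < p.2} ⊕ Sym2 (Fin n)) :
    ∃ D, ∀ t : ℂ, stepMat s (y + t • blockDir b) = stepMat s y + t • D := by
  simp only [stepMat_eq]
  rcases b with p | w
  · obtain ⟨X, hXX, hX⟩ := exists_stepTri_add_smul s y p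
    have hsym (t : ℂ) : symMatrix (y + t • blockDir (Sum.inl p)).2 =
        symMatrix y.2 + stepTri s y * (t • 0) * (stepTri s y)ᵀ := by simp [blockDir]
    refine ⟨signConj s (elemMinus (stepTri s y) (symMatrix y.2) *
      Matrix.fromBlocks (-Xᵀ) 0 0 X), fun t => ?_⟩
    rw [hX, hsym, ← elemMinus_mul (isUnit_det_stepTri s y),
      elemMinus_one_add_smul hXX (zero_mul _), mul_add, mul_one, mul_smul_comm]
    rfl
  · have htri (t : ℂ) : stepTri s (y + t • blockDir (Sum.inr w)) = stepTri s y := by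
      cases s <;> simp [stepTri, blockDir]
    have hsym (t : ℂ) : symMatrix (y + t • blockDir (Sum.inr w)).2 =
        symMatrix y.2 + t • symMatrix (Pi.single w 1) := by
      ext i j; simp [symMatrix, blockDir]
    refine ⟨signConj s (Matrix.fromBlocks 0 0
      (symMatrix (Pi.single w 1) * ((stepTri s y)⁻¹)ᵀ) 0), fun t => ?_⟩
    have hblock : elemMinus (stepTri s y) (symMatrix y.2 + t • symMatrix (Pi.single w 1)) =
        elemMinus (stepTri s y) (symMatrix y.2) +
          t • Matrix.fromBlocks 0 0 (symMatrix (Pi.single w 1) * ((stepTri s y)⁻¹)ᵀ) 0 := by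
      rw [elemMinus_eq, elemMinus_eq, Matrix.fromBlocks_smul, Matrix.fromBlocks_add]
      simp [add_mul]
    rw [htri, hsym, hblock]
    rfl

theorem stepMat_add_smul (b : {p : Fin n × Fin n // p.1 < p.2} ⊕ Sym2 (Fin n)) (t : ℂ) :
    stepMat s (y + t • blockDir b) =
      stepMat s y + t • (stepMat s (y + blockDir b) - stepMat s y) := by
  obtain ⟨D, hD⟩ := exists_stepMat_add_smul s y b
  have hone := hD 1
  rw [one_smul, one_smul] at hone
  rw [hD, hone, add_sub_cancel_left]

end Directions

/-! ### Critical pairs -/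

section Critical

variable {n : ℕ}

/-- The pairing of the row `u` with the column `c` vanishes on the Lie algebra of the group of
factors of sign `-`. -/
def IsCritPair (u c : Fin n ⊕ Fin n → ℂ) : Prop :=
  (∀ i j, u (Sum.inr i) * c (Sum.inl j) + u (Sum.inr j) * c (Sum.inl i) = 0) ∧
    ∀ i j, i < j → u (Sum.inr i) * c (Sum.inr j) - u (Sum.inl j) * c (Sum.inl i) = 0

theorem vecMul_single_dotProduct {m : Type*} [Fintype m] [DecidableEq m] (a b : m → ℂ) (i j : m) :
    (a ᵥ* Matrix.single i j 1) ⬝ᵥ b = a i * b j := by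
  rw [Matrix.single_eq_single_vecMulVec_single, Matrix.vecMul_vecMulVec, smul_dotProduct,
    single_dotProduct, dotProduct_single, mul_one, one_mul, smul_eq_mul]

theorem vecMul_fromBlocks_dotProduct (u c : Fin n ⊕ Fin n → ℂ)
    (P Q R S : Matrix (Fin n) (Fin n) ℂ) :
    (u ᵥ* Matrix.fromBlocks P Q R S) ⬝ᵥ c =
      ((u ∘ Sum.inl) ᵥ* P) ⬝ᵥ (c ∘ Sum.inl) + ((u ∘ Sum.inr) ᵥ* R) ⬝ᵥ (c ∘ Sum.inl) +
        (((u ∘ Sum.inl) ᵥ* Q) ⬝ᵥ (c ∘ Sum.inr) + ((u ∘ Sum.inr) ᵥ* S) ⬝ᵥ (c ∘ Sum.inr)) := by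
  rw [Matrix.vecMul_fromBlocks, ← Sum.elim_comp_inl_inr c, sumElim_dotProduct_sumElim,
    add_dotProduct, add_dotProduct, Sum.elim_comp_inl, Sum.elim_comp_inr]

theorem isCritPair_of_forall {u c : Fin n ⊕ Fin n → ℂ}
    (h : ∀ X S : Matrix (Fin n) (Fin n) ℂ, (∀ i j, j ≤ i → X i j = 0) → X * X = 0 → Sᵀ = S →
      S * Xᵀ = 0 → (u ᵥ* Matrix.fromBlocks (-Xᵀ) 0 S X) ⬝ᵥ c = 0) : IsCritPair u c := by
  refine ⟨fun i j => ?_, fun i j hij => ?_⟩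
  · have hsym := h 0 (Matrix.single i j 1 + Matrix.single j i 1) (fun _ _ _ => rfl)
      (zero_mul 0) (by simp [add_comm]) (by simp)
    simpa [vecMul_fromBlocks_dotProduct, Matrix.vecMul_add, vecMul_single_dotProduct] using hsym
  · have htri := h (Matrix.single i j 1) 0
      (fun k l hlk => Matrix.single_apply_of_ne _ _ _ _ _ fun e => by
        rw [e.1, e.2] at hij; exact hij.not_ge hlk)
      (by simp [hij.ne']) Matrix.transpose_zero (zero_mul _)
    simp only [vecMul_fromBlocks_dotProduct, Matrix.transpose_single, Matrix.vecMul_neg,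
      neg_dotProduct, vecMul_single_dotProduct, Matrix.vecMul_zero, zero_dotProduct, add_zero,
      zero_add, Function.comp_apply] at htri
    linear_combination htri

theorem eq_zero_of_hasFDerivAt_zero_of_affine {G : Type*} [NormedAddCommGroup G] [NormedSpace ℂ G]
    {g : G → ℂ} {γ : ℂ → G} {κ₀ κ : ℂ} (hg : HasFDerivAt g (0 : G →L[ℂ] ℂ) (γ 0))
    (hγ : DifferentiableAt ℂ γ 0) (h : ∀ t, g (γ t) = κ₀ + t * κ) : κ = 0 := by
  have hzero : HasDerivAt (g ∘ γ) 0 0 := hg.comp_hasDerivAt (0 : ℂ) hγ.hasDerivAt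
  have haffine : HasDerivAt (g ∘ γ) κ 0 := by
    rw [show g ∘ γ = fun t => κ₀ + t * κ from funext h]
    simpa using ((hasDerivAt_id (0 : ℂ)).mul_const κ).const_add κ₀
  exact haffine.unique hzero

section Step

variable (s : Bool) (y : UnitriCoord n × SymCoord n)

theorem stepMulElem_one_zero : stepMulElem s y 1 0 = y := by
  rw [stepMulElem, mul_one, mul_zero, zero_mul, add_zero, stepCoord_stepTri]

theorem elemMulStep_one_zero : elemMulStep s y 1 0 = y := by
  rw [elemMulStep, one_mul, one_mul, Matrix.transpose_one, mul_one, zero_add, stepCoord_stepTri]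

variable {X S : Matrix (Fin n) (Fin n) ℂ}

theorem vecMul_signConj_one_add_smul_dotProduct (hX : X * X = 0) (hS : S * Xᵀ = 0)
    (u c : Fin n ⊕ Fin n → ℂ) (t : ℂ) :
    (u ᵥ* signConj s (elemMinus (1 + t • X) (t • S))) ⬝ᵥ c = (u ∘ signSwap s) ⬝ᵥ (c ∘ signSwap s) +
      t * (((u ∘ signSwap s) ᵥ* Matrix.fromBlocks (-Xᵀ) 0 S X) ⬝ᵥ (c ∘ signSwap s)) := by
  rw [vecMul_signConj]
  conv_lhs => rw [← signSwap_symm]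
  rw [comp_equiv_symm_dotProduct, signSwap_symm, elemMinus_one_add_smul hX hS, Matrix.vecMul_add,
    Matrix.vecMul_one, Matrix.vecMul_smul, add_dotProduct, smul_dotProduct, smul_eq_mul]

theorem isUnitriangular_one_add_smul (hX : ∀ i j, j ≤ i → X i j = 0) (t : ℂ) :
    IsUnitriangular id (1 + t • X) :=
  isUnitriangular_one_add fun i j hij => by rw [Matrix.smul_apply, hX i j hij, smul_zero]

theorem entryAnalytic_one_add_smul (X : Matrix (Fin n) (Fin n) ℂ) :
    EntryAnalytic (fun t : ℂ => 1 + t • X) 0 :=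
  .add (.const 1 0) (.smul analyticAt_id (.const X 0))

theorem entryAnalytic_smul_const (S : Matrix (Fin n) (Fin n) ℂ) :
    EntryAnalytic (fun t : ℂ => t • S) 0 :=
  .smul analyticAt_id (.const S 0)

variable {s y} {r c : Fin n ⊕ Fin n → ℂ}
  (h : HasFDerivAt (fun y => (r ᵥ* stepMat s y) ⬝ᵥ c) (0 : _ →L[ℂ] ℂ) y)
include h

theorem isCritPair_right : IsCritPair ((r ᵥ* stepMat s y) ∘ signSwap s) (c ∘ signSwap s) := by
  refine isCritPair_of_forall fun X S hX hXX hS hSX => ?_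
  have hC := isUnitriangular_one_add_smul hX
  have hcurve : AnalyticAt ℂ (fun t : ℂ => stepMulElem s y (1 + t • X) (t • S)) 0 :=
    analyticAt_stepMulElem s analyticAt_const (entryAnalytic_one_add_smul X)
      ((hC 0).isUnit_det Function.injective_id) (entryAnalytic_smul_const S)
  refine eq_zero_of_hasFDerivAt_zero_of_affine (g := fun y => (r ᵥ* stepMat s y) ⬝ᵥ c)
    (κ₀ := ((r ᵥ* stepMat s y) ∘ signSwap s) ⬝ᵥ (c ∘ signSwap s)) ?_ hcurve.differentiableAt
    fun t => ?_
  · rwa [zero_smul, zero_smul, add_zero, stepMulElem_one_zero]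
  · rw [stepMat_stepMulElem s y (hC t) (by rw [Matrix.transpose_smul, hS]),
      ← Matrix.vecMul_vecMul, vecMul_signConj_one_add_smul_dotProduct s hXX hSX]

theorem isCritPair_left : IsCritPair (r ∘ signSwap s) ((stepMat s y *ᵥ c) ∘ signSwap s) := by
  refine isCritPair_of_forall fun X S hX hXX hS hSX => ?_
  have hC := isUnitriangular_one_add_smul hX
  have hcurve : AnalyticAt ℂ (fun t : ℂ => elemMulStep s y (1 + t • X) (t • S)) 0 :=
    analyticAt_elemMulStep s analyticAt_const (entryAnalytic_one_add_smul X)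
      ((hC 0).isUnit_det Function.injective_id) (entryAnalytic_smul_const S)
  refine eq_zero_of_hasFDerivAt_zero_of_affine (g := fun y => (r ᵥ* stepMat s y) ⬝ᵥ c)
    (κ₀ := (r ∘ signSwap s) ⬝ᵥ ((stepMat s y *ᵥ c) ∘ signSwap s)) ?_ hcurve.differentiableAt
    fun t => ?_
  · rwa [zero_smul, zero_smul, add_zero, elemMulStep_one_zero]
  · rw [stepMat_elemMulStep s y (hC t) (by rw [Matrix.transpose_smul, hS]),
      ← Matrix.vecMul_vecMul, ← Matrix.dotProduct_mulVec,
      vecMul_signConj_one_add_smul_dotProduct s hXX hSX]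

end Step

/-- The last standard basis row vector `e_{2n}ᵀ`. -/
abbrev baseRow (n : ℕ) : Fin n ⊕ Fin n → ℂ := Sum.elim 0 (lastVec n)

theorem baseRow_vecMul_elemPlus (A Z : Matrix (Fin n) (Fin n) ℂ) :
    baseRow n ᵥ* elemPlus A Z = Sum.elim (0 : Fin n → ℂ) (A *ᵥ lastVec n) := by
  simp [elemPlus_eq, Matrix.vecMul_fromBlocks, Matrix.vecMul_transpose]

theorem elemMinus_mulVec_baseRow (A Z : Matrix (Fin n) (Fin n) ℂ) :
    elemMinus A Z *ᵥ baseRow n = Sum.elim (0 : Fin n → ℂ) (A *ᵥ lastVec n) := by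
  simp [elemMinus_eq, Matrix.fromBlocks_mulVec]

variable [NeZero n]

/-- The last index, `n` in the paper. -/
def lastIdx (n : ℕ) [NeZero n] : Fin n := ⟨n - 1, Nat.sub_one_lt (NeZero.ne n)⟩

theorem lt_lastIdx {i : Fin n} (h : i ≠ lastIdx n) : i < lastIdx n := by
  have hval : (i : ℕ) ≠ n - 1 := fun e => h (Fin.ext e)
  exact Nat.lt_of_le_of_ne (Nat.le_sub_one_of_lt i.2) hval

theorem lastVec_eq : lastVec n = Pi.single (lastIdx n) 1 := by
  ext i
  have hlast : (i : ℕ) + 1 = n ↔ i = lastIdx n := by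
    rw [Fin.ext_iff, lastIdx, eq_comm, ← Nat.sub_eq_iff_eq_add (NeZero.one_le), eq_comm]
  simp only [lastVec, Pi.single_apply, hlast]

theorem baseRow_eq : baseRow n = Pi.single (Sum.inr (lastIdx n)) 1 := by
  rw [baseRow, lastVec_eq, Sum.elim_zero_single]

section Pair

variable {u c : Fin n ⊕ Fin n → ℂ} (hminus : IsCritPair u c)
  (hplus : IsCritPair (u ∘ Sum.swap) (c ∘ Sum.swap))
include hminus hplus

theorem column_eq_smul_baseRow_of_isCritPair (hu : u (Sum.inr (lastIdx n)) = 1) :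
    c = c (Sum.inr (lastIdx n)) • baseRow n := by
  have hlast : c (Sum.inl (lastIdx n)) = 0 := by
    have hsym := hminus.1 (lastIdx n) (lastIdx n)
    rwa [hu, one_mul, add_self_eq_zero] at hsym
  have hinl (i : Fin n) : c (Sum.inl i) = 0 := by
    have hsym := hminus.1 (lastIdx n) i
    rwa [hu, hlast, mul_zero, one_mul, add_zero] at hsym
  rw [baseRow_eq]
  ext (i | i)
  · simp [hinl]
  · by_cases hi : i = lastIdx n
    · simp [hi]
    · have htri := hplus.2 i (lastIdx n) (lt_lastIdx hi)
      simpa [hinl, hu, hi] using htri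

theorem row_eq_baseRow_of_isCritPair (hu : u (Sum.inr (lastIdx n)) = 1) (hc : c ≠ 0) :
    u = baseRow n := by
  have hcol := column_eq_smul_baseRow_of_isCritPair hminus hplus hu
  have hcn : c (Sum.inr (lastIdx n)) ≠ 0 := fun h => hc (by rw [hcol, h, zero_smul])
  rw [baseRow_eq] at hcol ⊢
  have hcl (l : Fin n ⊕ Fin n) (hl : l ≠ Sum.inr (lastIdx n)) : c l = 0 := by
    rw [hcol]; simp [hl]
  have hlast : u (Sum.inl (lastIdx n)) = 0 := by
    simpa [← two_mul, hcn] using hplus.1 (lastIdx n) (lastIdx n)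
  ext (i | i)
  · simpa [hlast, hcn] using hplus.1 i (lastIdx n)
  · by_cases hi : i = lastIdx n
    · simp [hi, hu]
    · simpa [hcl, hcn, hi] using hminus.2 i (lastIdx n) (lt_lastIdx hi)

end Pair

section Fix

variable {A Z : Matrix (Fin n) (Fin n) ℂ} (hA : IsUnitriangular id A)
include hA

theorem transpose_mulVec_lastVec : Aᵀ *ᵥ lastVec n = lastVec n := by
  rw [lastVec_eq, Matrix.mulVec_single_one]
  ext i
  by_cases hi : i = lastIdx n
  · simp [hi, hA.2]
  · rw [Pi.single_eq_of_ne hi]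
    exact hA.1 (lt_lastIdx hi)

theorem baseRow_vecMul_elemMinus (hZ : Zᵀ = Z) :
    baseRow n ᵥ* elemMinus A Z = Sum.elim (A⁻¹ *ᵥ Z *ᵥ lastVec n) (lastVec n) := by
  have hlast : lastVec n ᵥ* A = lastVec n := by
    rw [← Matrix.mulVec_transpose, transpose_mulVec_lastVec hA]
  rw [elemMinus_eq, Matrix.vecMul_fromBlocks, Sum.elim_comp_inl, Sum.elim_comp_inr, hlast,
    ← Matrix.vecMul_vecMul, Matrix.vecMul_transpose, ← Matrix.mulVec_transpose Z, hZ]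
  simp [Matrix.vecMul_transpose]

theorem elemPlus_mulVec_baseRow :
    elemPlus A Z *ᵥ baseRow n = Sum.elim (Z *ᵥ lastVec n) (lastVec n) := by
  rw [elemPlus_eq, Matrix.fromBlocks_mulVec, Sum.elim_comp_inl, Sum.elim_comp_inr,
    ← Matrix.mulVec_mulVec, transpose_mulVec_lastVec hA]
  simp

end Fix

variable (s : Bool) (y : UnitriCoord n × SymCoord n)

theorem baseRow_vecMul_stepMat_true_iff :
    baseRow n ᵥ* stepMat true y = baseRow n ↔ symMatrix y.2 *ᵥ lastVec n = 0 := by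
  have hA := isUnitriangular_unitriMatrix y.1
  have hinv : IsUnit (unitriMatrix y.1)⁻¹ := (Matrix.isUnit_nonsing_inv_iff).2
    ((Matrix.isUnit_iff_isUnit_det _).2 (hA.isUnit_det Function.injective_id))
  rw [stepMat, baseRow_vecMul_elemMinus hA (symMatrix_transpose _), Sum.elim_eq_iff,
    and_iff_left rfl, (Matrix.mulVec_injective_of_isUnit hinv).eq_iff' (Matrix.mulVec_zero _)]

theorem stepMat_fix_iff :
    (baseRow n ᵥ* stepMat s y = baseRow n ∧ stepMat s y *ᵥ baseRow n = baseRow n) ↔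
      symMatrix y.2 *ᵥ lastVec n = 0 ∧ unitriMatrix y.1 *ᵥ lastVec n = lastVec n := by
  cases s
  · rw [stepMat, baseRow_vecMul_elemPlus,
      elemPlus_mulVec_baseRow (isUnitriangular_unitriMatrix y.1), Sum.elim_eq_iff,
      Sum.elim_eq_iff, and_iff_right rfl, and_iff_left rfl, and_comm]
  · rw [baseRow_vecMul_stepMat_true_iff, stepMat, elemMinus_mulVec_baseRow, Sum.elim_eq_iff,
      and_iff_right rfl]

theorem baseRow_vecMul_stepMat_apply :
    (baseRow n ᵥ* stepMat s y) (Sum.inr (lastIdx n)) = 1 := by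
  rw [baseRow_eq, Matrix.single_one_vecMul]
  exact (isUnitriangular_stepMat s y).2 _

end Critical

/-! ### Chains of rows and columns -/

section Chain

variable {n : ℕ}

/-- The sign of the factor with index `k`, as an argument of `stepMat`. -/
def stepSign (k : ℕ) : Bool := decide (Even k)

theorem stepSign_succ (k : ℕ) : stepSign (k + 1) = !stepSign k := by
  simp only [stepSign, Nat.even_add_one, decide_not]

/-- The last row of the product of the first `k` factors. -/
noncomputable def rowAt (X : ℕ → UnitriCoord n × SymCoord n) : ℕ → Fin n ⊕ Fin n → ℂ
  | 0 => baseRow n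
  | k + 1 => rowAt X k ᵥ* stepMat (stepSign k) (X k)

/-- The product of the `j` factors from index `k` on, applied to the column `c`. -/
noncomputable def colAt (X : ℕ → UnitriCoord n × SymCoord n) (c : Fin n ⊕ Fin n → ℂ) :
    ℕ → ℕ → Fin n ⊕ Fin n → ℂ
  | 0, _ => c
  | j + 1, k => stepMat (stepSign k) (X k) *ᵥ colAt X c j (k + 1)

variable {X X' : ℕ → UnitriCoord n × SymCoord n} {c : Fin n ⊕ Fin n → ℂ} {j k K : ℕ}

theorem rowAt_add_dotProduct (X : ℕ → UnitriCoord n × SymCoord n) (c : Fin n ⊕ Fin n → ℂ)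
    (j k : ℕ) : rowAt X (k + j) ⬝ᵥ c = rowAt X k ⬝ᵥ colAt X c j k := by
  induction j generalizing k with
  | zero => rfl
  | succ j ih =>
    rw [colAt, Matrix.dotProduct_mulVec, ← rowAt, ← ih, Nat.succ_add_eq_add_succ]

theorem rowAt_congr (h : ∀ i < k, X i = X' i) : rowAt X k = rowAt X' k := by
  induction k with
  | zero => rfl
  | succ k ih => rw [rowAt, rowAt, ih fun i hi => h i (by omega), h k (by omega)]

theorem colAt_congr (c : Fin n ⊕ Fin n → ℂ) (h : ∀ i, k ≤ i → X i = X' i) :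
    colAt X c j k = colAt X' c j k := by
  induction j generalizing k with
  | zero => rfl
  | succ j ih => rw [colAt, colAt, ih fun i hi => h i (by omega), h k le_rfl]

theorem rowAt_update_dotProduct (X : ℕ → UnitriCoord n × SymCoord n) (c : Fin n ⊕ Fin n → ℂ)
    (k j : ℕ) (y : UnitriCoord n × SymCoord n) :
    rowAt (Function.update X k y) (k + 1 + j) ⬝ᵥ c =
      (rowAt X k ᵥ* stepMat (stepSign k) y) ⬝ᵥ colAt X c j (k + 1) := by
  rw [rowAt_add_dotProduct, rowAt, Function.update_self,
    rowAt_congr (X' := X) fun i hi => Function.update_of_ne hi.ne _ _,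
    colAt_congr (X' := X) c fun i hi => Function.update_of_ne (by omega) _ _]

theorem isUnit_stepMat (s : Bool) (y : UnitriCoord n × SymCoord n) : IsUnit (stepMat s y) :=
  (Matrix.isUnit_iff_isUnit_det _).2 (isUnit_det_stepMat s y)

theorem colAt_ne_zero (X : ℕ → UnitriCoord n × SymCoord n) (hc : c ≠ 0) (j k : ℕ) :
    colAt X c j k ≠ 0 := by
  induction j generalizing k with
  | zero => exact hc
  | succ j ih =>
    exact (Matrix.mulVec_injective_of_isUnit (isUnit_stepMat _ _)).ne_iff' (Matrix.mulVec_zero _)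
      |>.2 (ih (k + 1))

/-- The differential of the pairing of the last row with the column `c` vanishes on each of the
first `K` factors, all others being fixed. -/
def IsCriticalChain (X : ℕ → UnitriCoord n × SymCoord n) (c : Fin n ⊕ Fin n → ℂ) (K : ℕ) : Prop :=
  ∀ k j, k + 1 + j = K → HasFDerivAt (fun y =>
    (rowAt X k ᵥ* stepMat (stepSign k) y) ⬝ᵥ colAt X c j (k + 1)) (0 : _ →L[ℂ] ℂ) (X k)

namespace IsCriticalChain

variable (h : IsCriticalChain X c K)
include h

theorem isCritPair (hk : k + 1 + (j + 1) = K) (s : Bool) :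
    IsCritPair (rowAt X (k + 1) ∘ signSwap s) (colAt X c (j + 1) (k + 1) ∘ signSwap s) := by
  rcases Bool.eq_or_eq_not s (stepSign k) with rfl | rfl
  · exact isCritPair_right (h k (j + 1) hk)
  · rw [← stepSign_succ]
    exact isCritPair_left (h (k + 1) j (by omega))

end IsCriticalChain

variable [NeZero n]

theorem baseRow_dotProduct (v : Fin n ⊕ Fin n → ℂ) :
    baseRow n ⬝ᵥ v = v (Sum.inr (lastIdx n)) := by
  rw [baseRow_eq, single_dotProduct, one_mul]

theorem rowAt_ne_zero (X : ℕ → UnitriCoord n × SymCoord n) (k : ℕ) : rowAt X k ≠ 0 := by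
  induction k with
  | zero =>
    rw [rowAt, baseRow_eq]
    exact Pi.single_ne_zero_iff.2 one_ne_zero
  | succ k ih =>
    exact (Matrix.vecMul_injective_of_isUnit (isUnit_stepMat _ _)).ne_iff' (Matrix.zero_vecMul _)
      |>.2 ih

namespace IsCriticalChain

variable (h : IsCriticalChain X c K) (hc : c ≠ 0)
include h hc

theorem rowAt_eq_baseRow (hk : k + 1 + j = K) : rowAt X k = baseRow n := by
  induction k generalizing j with
  | zero => rfl
  | succ k ih =>
    have hcrit := h.isCritPair (k := k) (j := j) (by omega)
    refine row_eq_baseRow_of_isCritPair (hcrit true) (hcrit false) ?_ (colAt_ne_zero X hc _ _)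
    rw [rowAt, ih (j := j + 1) (by omega)]
    exact baseRow_vecMul_stepMat_apply _ _

theorem colAt_eq_smul_baseRow (hk : k + 1 + (j + 1) = K) :
    colAt X c (j + 1) (k + 1) =
      colAt X c (j + 1) (k + 1) (Sum.inr (lastIdx n)) • baseRow n := by
  have hcrit := h.isCritPair hk
  refine column_eq_smul_baseRow_of_isCritPair (u := rowAt X (k + 1)) (hcrit true) (hcrit false) ?_
  rw [h.rowAt_eq_baseRow hc (j := j) (by omega), baseRow_eq, Pi.single_eq_same]

theorem baseRow_vecMul_stepMat (hk : k + 1 < K) :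
    baseRow n ᵥ* stepMat (stepSign k) (X k) = baseRow n := by
  have hnext := h.rowAt_eq_baseRow hc (k := k + 1) (Nat.add_sub_of_le hk)
  rwa [rowAt, h.rowAt_eq_baseRow hc (j := K - (k + 1)) (by omega)] at hnext

theorem stepMat_mulVec_baseRow (hk₀ : 0 < k) (hk : k + 1 < K) :
    stepMat (stepSign k) (X k) *ᵥ baseRow n = baseRow n := by
  obtain ⟨k, rfl⟩ := Nat.exists_eq_succ_of_ne_zero hk₀.ne'
  obtain ⟨j, rfl⟩ := Nat.exists_eq_add_of_lt hk
  set M := stepMat (stepSign (k + 1)) (X (k + 1))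
  set w := colAt X c (j + 1) (k + 2)
  have hin : w = w (Sum.inr (lastIdx n)) • baseRow n :=
    h.colAt_eq_smul_baseRow hc (k := k + 1) rfl
  have hout : M *ᵥ w = (M *ᵥ w) (Sum.inr (lastIdx n)) • baseRow n :=
    h.colAt_eq_smul_baseRow hc (k := k) (j := j + 1) (by omega)
  have hlast : (M *ᵥ w) (Sum.inr (lastIdx n)) = w (Sum.inr (lastIdx n)) := by
    rw [← baseRow_dotProduct (M *ᵥ w), Matrix.dotProduct_mulVec, h.baseRow_vecMul_stepMat hc hk,
      baseRow_dotProduct]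
  have hw : w (Sum.inr (lastIdx n)) ≠ 0 := fun hzero =>
    colAt_ne_zero X hc (j + 1) (k + 2) (hin.trans (by rw [hzero, zero_smul]))
  rw [hlast] at hout
  refine smul_right_injective _ hw ?_
  beta_reduce
  rw [← Matrix.mulVec_smul, ← hin, hout, ← hin]

end IsCriticalChain

end Chain

/-! ### The last row as a map -/

section Phi

variable {n K : ℕ}

/-- A finite sequence of parameters, continued by zero. -/
noncomputable def extendZero (x : ParamSpace n K) : ℕ → UnitriCoord n × SymCoord n :=
  fun k => if h : k < K then x ⟨k, h⟩ else 0

theorem extendZero_apply (x : ParamSpace n K) (k : Fin K) : extendZero x k = x k :=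
  dif_pos k.2

theorem extendZero_update (x : ParamSpace n K) (k : Fin K) (y : UnitriCoord n × SymCoord n) :
    extendZero (Function.update x k y) = Function.update (extendZero x) k y := by
  ext1 i
  by_cases hi : i < K
  · lift i to Fin K using hi
    simp only [extendZero_apply, Function.update_apply, Fin.val_inj]
  · simp [extendZero, hi, (k.2.trans_le (not_lt.1 hi)).ne']

theorem vecMul_prod_ofFn (X : ℕ → UnitriCoord n × SymCoord n) (m : ℕ) :
    baseRow n ᵥ* (List.ofFn fun k : Fin m => stepMat (stepSign k) (X k)).prod = rowAt X m := by
  induction m with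
  | zero => simp [rowAt]
  | succ m ih =>
    simp only [List.ofFn_succ', List.concat_eq_append, List.prod_append, List.prod_singleton,
      ← Matrix.vecMul_vecMul, Fin.val_castSucc, ih, Fin.val_last, rowAt]

theorem phiMap_eq (x : ParamSpace n K) : phiMap n K x = rowAt (extendZero x) K := by
  rw [phiMap, psiMap, ← vecMul_prod_ofFn]
  congr 3
  ext1 k
  by_cases hk : Even (k : ℕ) <;> simp [stepMat, stepSign, extendZero_apply, hk]

theorem analyticAt_extendZero (k : ℕ) (x : ParamSpace n K) :
    AnalyticAt ℂ (fun x : ParamSpace n K => extendZero x k) x := by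
  by_cases h : k < K
  · simp only [extendZero, h, dite_true]
    exact analyticAt_pi_iff.1 (analyticAt_id (𝕜 := ℂ)) _
  · simp only [extendZero, h, dite_false]
    exact analyticAt_const

theorem analyticAt_rowAt (m : ℕ) (x : ParamSpace n K) (l : Fin n ⊕ Fin n) :
    AnalyticAt ℂ (fun x : ParamSpace n K => rowAt (extendZero x) m l) x := by
  induction m generalizing l with
  | zero => exact analyticAt_const
  | succ m ih =>
    exact EntryAnalytic.vecMul ih (entryAnalytic_stepMat _ (analyticAt_extendZero m x)) l

theorem analyticAt_phiMap (x : ParamSpace n K) : AnalyticAt ℂ (phiMap n K) x := by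
  rw [funext phiMap_eq]
  exact analyticAt_pi_iff.2 fun l => analyticAt_rowAt K x l

theorem mem_singSet_iff [NeZero n] (hK : 1 < K) (x : ParamSpace n K) :
    x ∈ singSet n K ↔
      baseRow n ᵥ* stepMat (stepSign 0) (extendZero x 0) = baseRow n ∧
      ∀ k, 0 < k → k + 1 < K →
        baseRow n ᵥ* stepMat (stepSign k) (extendZero x k) = baseRow n ∧
        stepMat (stepSign k) (extendZero x k) *ᵥ baseRow n = baseRow n := by
  have hsign : stepSign 0 = true := rfl
  simp only [stepMat_fix_iff, hsign, baseRow_vecMul_stepMat_true_iff]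
  constructor
  · rintro ⟨hZ, hA⟩
    exact ⟨by simpa [extendZero, hK.pos] using hZ ⟨0, hK.pos⟩ hK, fun k hk₀ hk =>
      have hkK : k < K := by omega
      ⟨by simpa [extendZero, hkK] using hZ ⟨k, hkK⟩ hk,
        by simpa [extendZero, hkK] using hA ⟨k, hkK⟩ hk₀ hk⟩⟩
  · rintro ⟨hzero, hfix⟩
    simp only [singSet, Set.mem_ofPred_eq, ← extendZero_apply x]
    refine ⟨fun k hk => ?_, fun k hk₀ hk => (hfix k hk₀ hk).2⟩
    rcases Nat.eq_zero_or_pos (k : ℕ) with hk₀ | hk₀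
    · rwa [hk₀]
    · exact (hfix k hk₀ hk).1

theorem isClosed_singSet : IsClosed (singSet n K) := by
  have hsym : Continuous (symMatrix : SymCoord n → _) := continuous_matrix fun i j =>
    continuous_iff_continuousAt.2 fun _ =>
      (EntryAnalytic.symMatrix (analyticAt_id (𝕜 := ℂ)) i j).continuousAt
  have htri : Continuous (unitriMatrix : UnitriCoord n → _) := continuous_matrix fun i j =>
    continuous_iff_continuousAt.2 fun _ =>
      (EntryAnalytic.unitriMatrix (analyticAt_id (𝕜 := ℂ)) i j).continuousAt
  simp only [singSet, Set.ofPred_and, Set.ofPred_forall]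
  refine .inter (isClosed_iInter fun k => isClosed_iInter fun _ => isClosed_eq ?_ continuous_const)
    (isClosed_iInter fun k => isClosed_iInter fun _ => isClosed_iInter fun _ =>
      isClosed_eq ?_ continuous_const)
  · exact (hsym.comp (continuous_snd.comp (continuous_apply k))).matrix_mulVec continuous_const
  · exact (htri.comp (continuous_fst.comp (continuous_apply k))).matrix_mulVec continuous_const

theorem exists_dotProduct_comp_hasFDerivAt_zero {G ι : Type*} [NormedAddCommGroup G]
    [NormedSpace ℂ G] [Fintype ι] {g : G → ι → ℂ} {g' : G →L[ℂ] ι → ℂ} {x : G}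
    (hg : HasFDerivAt g g' x) (hg' : ¬Function.Surjective g') :
    ∃ c : ι → ℂ, c ≠ 0 ∧ HasFDerivAt (fun y => g y ⬝ᵥ c) (0 : G →L[ℂ] ℂ) x := by
  classical
  have hrange : LinearMap.range g'.toLinearMap < ⊤ :=
    lt_top_iff_ne_top.2 fun htop => hg' (LinearMap.range_eq_top.1 htop)
  obtain ⟨f, hf, hle⟩ := Submodule.exists_le_ker_of_lt_top _ hrange
  obtain ⟨c, rfl⟩ := (dotProductEquiv ℂ ι).surjective f
  refine ⟨c, fun hc => hf (by rw [hc, map_zero]), ?_⟩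
  have hcomp := ((dotProductEquiv ℂ ι c).toContinuousLinearMap).hasFDerivAt.comp x hg
  refine (hcomp.congr_fderiv (ContinuousLinearMap.ext fun v => ?_)).congr_of_eventuallyEq
    (.of_forall fun y => dotProduct_comm _ _)
  exact hle ⟨v, rfl⟩

theorem isCriticalChain_extendZero {z : ParamSpace n K} {c : Fin n ⊕ Fin n → ℂ}
    (h : HasFDerivAt (fun x => phiMap n K x ⬝ᵥ c) (0 : ParamSpace n K →L[ℂ] ℂ) z) :
    IsCriticalChain (extendZero z) c K := by
  intro k j hkj
  lift k to Fin K using by omega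
  have hpair : (fun x => phiMap n K x ⬝ᵥ c) ∘ Function.update z k = fun y =>
      (rowAt (extendZero z) k ᵥ* stepMat (stepSign k) y) ⬝ᵥ
        colAt (extendZero z) c j (k + 1) := by
    ext y
    rw [Function.comp_apply, phiMap_eq, extendZero_update, ← rowAt_update_dotProduct, hkj]
  rw [← Function.update_eq_self k z] at h
  have hcomp := h.comp (z k) (hasFDerivAt_update (𝕜 := ℂ) z (z k))
  rwa [hpair, ContinuousLinearMap.zero_comp, ← extendZero_apply z] at hcomp

theorem mem_singSet_of_hasFDerivAt_zero [NeZero n] (hK : 1 < K) {z : ParamSpace n K}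
    {c : Fin n ⊕ Fin n → ℂ} (hc : c ≠ 0)
    (h : HasFDerivAt (fun x => phiMap n K x ⬝ᵥ c) (0 : ParamSpace n K →L[ℂ] ℂ) z) :
    z ∈ singSet n K := by
  have hcrit := isCriticalChain_extendZero h
  exact (mem_singSet_iff hK z).2 ⟨hcrit.baseRow_vecMul_stepMat hc (by omega), fun k hk₀ hk =>
    ⟨hcrit.baseRow_vecMul_stepMat hc hk, hcrit.stepMat_mulVec_baseRow hc hk₀ hk⟩⟩

theorem surjective_fderiv_phiMap [NeZero n] (hK : 1 < K) {z : ParamSpace n K}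
    (hz : z ∉ singSet n K) : Function.Surjective (fderiv ℂ (phiMap n K) z) := by
  by_contra hsurj
  obtain ⟨c, hc, hzero⟩ := exists_dotProduct_comp_hasFDerivAt_zero
    (analyticAt_phiMap z).differentiableAt.hasFDerivAt hsurj
  exact hz (mem_singSet_of_hasFDerivAt_zero hK hc hzero)

theorem isHolomorphicSubmersion_phiMap [NeZero n] (hK : 1 < K) :
    IsHolomorphicSubmersion (phiMap n K) (singSet n K)ᶜ ({0}ᶜ : Set (Fin n ⊕ Fin n → ℂ)) := by
  refine isHolomorphicSubmersion_of_surjective_fderiv isClosed_singSet.isOpen_compl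
    isOpen_compl_singleton (fun x _ => ?_) (fun x _ => analyticAt_phiMap x)
    fun z hz => surjective_fderiv_phiMap hK hz
  rw [phiMap_eq]
  exact rowAt_ne_zero _ _

/-- The coordinate vectors of the parameter space. -/
def paramDir (i : Fin K × ({p : Fin n × Fin n // p.1 < p.2} ⊕ Sym2 (Fin n))) : ParamSpace n K :=
  Pi.single i.1 (blockDir i.2)

theorem span_range_paramDir :
    Submodule.span ℂ (Set.range (paramDir (n := n) (K := K))) = ⊤ := by
  rw [eq_top_iff]
  intro x _
  rw [← Finset.univ_sum_single x]
  refine Submodule.sum_mem _ fun k _ => ?_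
  have hk : x k ∈ Submodule.span ℂ (Set.range (blockDir (n := n))) :=
    span_range_blockDir ▸ Submodule.mem_top
  have hsingle := Submodule.mem_map_of_mem
    (f := LinearMap.single ℂ (fun _ : Fin K => UnitriCoord n × SymCoord n) k) hk
  rw [Submodule.map_span] at hsingle
  refine Submodule.span_mono ?_ hsingle
  rintro _ ⟨_, ⟨b, rfl⟩, rfl⟩
  exact ⟨(k, b), rfl⟩

variable (i : Fin K × ({p : Fin n × Fin n // p.1 < p.2} ⊕ Sym2 (Fin n)))

theorem extendZero_add_smul_paramDir (x : ParamSpace n K) (t : ℂ) :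
    extendZero (x + t • paramDir i) =
      Function.update (extendZero x) i.1 (x i.1 + t • blockDir i.2) := by
  rw [← extendZero_update]
  congr 1
  ext1 k
  by_cases hk : k = i.1
  · subst hk; simp [paramDir]
  · simp [paramDir, hk]

theorem rowAt_add_smul_paramDir_of_le (x : ParamSpace n K) (t : ℂ) {m : ℕ} (hm : m ≤ i.1) :
    rowAt (extendZero (x + t • paramDir i)) m = rowAt (extendZero x) m := by
  rw [extendZero_add_smul_paramDir]
  exact rowAt_congr fun a ha => Function.update_of_ne (by omega) _ _

theorem rowAt_add_smul_paramDir (x : ParamSpace n K) (t : ℂ) (j : ℕ) (d : Fin n ⊕ Fin n) :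
    rowAt (extendZero (x + t • paramDir i)) (i.1 + 1 + j) d =
      (rowAt (extendZero x) i.1 ᵥ* stepMat (stepSign i.1) (x i.1 + t • blockDir i.2)) ⬝ᵥ
        colAt (extendZero x) (Pi.single d 1) j (i.1 + 1) := by
  rw [← rowAt_update_dotProduct, dotProduct_single, mul_one, extendZero_add_smul_paramDir]

theorem affineAlong_rowAt (m : ℕ) (d : Fin n ⊕ Fin n) :
    AffineAlong (fun x : ParamSpace n K => rowAt (extendZero x) m d) (paramDir i) := by
  intro x t
  have hone : x + paramDir i = x + (1 : ℂ) • paramDir i := by rw [one_smul]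
  rw [fwdDiff, hone]
  rcases le_or_gt m i.1 with hm | hm
  · simp only [rowAt_add_smul_paramDir_of_le i x _ hm, sub_self, mul_zero, add_zero]
  · obtain ⟨j, rfl⟩ := Nat.exists_eq_add_of_le (Nat.succ_le_of_lt hm)
    have hx := rowAt_add_smul_paramDir i x 0 j d
    rw [zero_smul, add_zero] at hx
    simp only [Nat.succ_eq_add_one, hx, rowAt_add_smul_paramDir]
    simp only [stepMat_add_smul _ _ _ t, one_smul, zero_smul, add_zero, Matrix.vecMul_add,
      Matrix.vecMul_smul, Matrix.vecMul_sub, add_dotProduct, smul_dotProduct, sub_dotProduct,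
      smul_eq_mul]

end Phi

/-! ### The retraction onto the fibres -/

/-- `d` is the first coordinate, in the order given by `signRank s`, at which `v` does not
vanish. -/
def IsPivot {n : ℕ} (s : Bool) (d : Fin n ⊕ Fin n) (v : Fin n ⊕ Fin n → ℂ) : Prop :=
  v d ≠ 0 ∧ ∀ l, signRank s l < signRank s d → v l = 0

theorem exists_isPivot {n : ℕ} (s : Bool) {v : Fin n ⊕ Fin n → ℂ} (hv : v ≠ 0) :
    ∃ d, IsPivot s d v := by
  obtain ⟨d, hd, hmin⟩ := WellFounded.has_min (measure (signRank (n := n) s)).wf {l | v l ≠ 0}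
    (Function.ne_iff.1 hv)
  exact ⟨d, hd, fun l hl => by_contra fun hne => hmin l hne hl⟩

section Retraction

variable {n m : ℕ}

/-- The coordinates of the last factor but one, changed so that the pivot coordinate `d` of the
row behind this factor becomes its first nonzero one. -/
noncomputable def adjustPrev (d : Fin n ⊕ Fin n) (v : Fin n ⊕ Fin n → ℂ)
    (x : ParamSpace n (m + 2)) : UnitriCoord n × SymCoord n :=
  stepAdjust (stepSign m) (extendZero x m) d (rowAt (extendZero x) (m + 1)) v

/-- The row in front of the last factor after the change `adjustPrev`. -/
noncomputable def adjustRow (d : Fin n ⊕ Fin n) (v : Fin n ⊕ Fin n → ℂ)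
    (x : ParamSpace n (m + 2)) : Fin n ⊕ Fin n → ℂ :=
  rowAt (extendZero x) m ᵥ* stepMat (stepSign m) (adjustPrev d v x)

/-- The coordinates of the last factor, changed so that the final row is `v`. -/
noncomputable def adjustLast (d : Fin n ⊕ Fin n) (v : Fin n ⊕ Fin n → ℂ)
    (x : ParamSpace n (m + 2)) : UnitriCoord n × SymCoord n :=
  stepAdjust (stepSign (m + 1)) (extendZero x (m + 1)) d
    (adjustRow d v x ᵥ* stepMat (stepSign (m + 1)) (extendZero x (m + 1))) v

/-- The retraction onto the fibre over `v` of the set of points for which the row behind all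
factors but the last has the pivot coordinate `v d`. -/
noncomputable def fiberRetract (d : Fin n ⊕ Fin n) (v : Fin n ⊕ Fin n → ℂ)
    (x : ParamSpace n (m + 2)) : ParamSpace n (m + 2) :=
  Function.update (Function.update x ⟨m, by omega⟩ (adjustPrev d v x)) ⟨m + 1, by omega⟩
    (adjustLast d v x)

variable {d : Fin n ⊕ Fin n} {v : Fin n ⊕ Fin n → ℂ} {x : ParamSpace n (m + 2)}

theorem extendZero_fiberRetract : extendZero (fiberRetract d v x) =
    Function.update (Function.update (extendZero x) m (adjustPrev d v x)) (m + 1)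
      (adjustLast d v x) := by
  rw [fiberRetract, extendZero_update, extendZero_update]

theorem extendZero_fiberRetract_of_lt {k : ℕ} (hk : k < m) :
    extendZero (fiberRetract d v x) k = extendZero x k := by
  rw [extendZero_fiberRetract, Function.update_of_ne (by omega), Function.update_of_ne (by omega)]

theorem extendZero_fiberRetract_prev :
    extendZero (fiberRetract d v x) m = adjustPrev d v x := by
  rw [extendZero_fiberRetract, Function.update_of_ne (by omega), Function.update_self]

theorem rowAt_fiberRetract_of_le {k : ℕ} (hk : k ≤ m) :
    rowAt (extendZero (fiberRetract d v x)) k = rowAt (extendZero x) k :=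
  rowAt_congr fun _ hi => extendZero_fiberRetract_of_lt (hi.trans_le hk)

theorem rowAt_fiberRetract_prev :
    rowAt (extendZero (fiberRetract d v x)) (m + 1) = adjustRow d v x := by
  rw [rowAt, rowAt_fiberRetract_of_le le_rfl, extendZero_fiberRetract_prev, adjustRow]

theorem phiMap_fiberRetract : phiMap n (m + 2) (fiberRetract d v x) =
    adjustRow d v x ᵥ* stepMat (stepSign (m + 1)) (adjustLast d v x) := by
  rw [phiMap_eq, rowAt, rowAt_fiberRetract_prev, extendZero_fiberRetract, Function.update_self]

theorem adjustRow_apply_pivot : adjustRow d v x d = rowAt (extendZero x) (m + 1) d :=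
  vecMul_stepAdjust_pivot ..

theorem adjustRow_apply_of_lt (hv : IsPivot (stepSign (m + 1)) d v)
    (hx : rowAt (extendZero x) (m + 1) d = v d) {l : Fin n ⊕ Fin n}
    (hl : signRank (stepSign (m + 1)) l < signRank (stepSign (m + 1)) d) :
    adjustRow d v x l = 0 := by
  rw [← hv.2 l hl]
  rw [stepSign_succ, signRank_not_lt_iff] at hl
  exact vecMul_stepAdjust_of_lt rfl hv.1 hx hl

theorem phiMap_fiberRetract_eq (hv : IsPivot (stepSign (m + 1)) d v)
    (hx : rowAt (extendZero x) (m + 1) d = v d) :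
    phiMap n (m + 2) (fiberRetract d v x) = v := by
  have hlt := fun l => adjustRow_apply_of_lt (l := l) hv hx
  have hpivot (y : UnitriCoord n × SymCoord n) :
      (adjustRow d v x ᵥ* stepMat (stepSign (m + 1)) y) d = v d :=
    ((isUnitriangular_stepMat _ y).vecMul_apply_pivot hlt (signRank_injective _)).trans
      (adjustRow_apply_pivot.trans hx)
  rw [phiMap_fiberRetract]
  ext l
  rcases lt_trichotomy (signRank (stepSign (m + 1)) l) (signRank (stepSign (m + 1)) d)
    with hl | hl | hl
  · rw [(isUnitriangular_stepMat _ _).vecMul_apply_of_lt hlt hl, hv.2 l hl]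
  · rw [signRank_injective _ hl, hpivot]
  · exact vecMul_stepAdjust_of_lt rfl hv.1 (hpivot _) hl

theorem rowAt_eq_phiMap_vecMul (x : ParamSpace n (m + 2)) :
    rowAt (extendZero x) (m + 1) =
      phiMap n (m + 2) x ᵥ* (stepMat (stepSign (m + 1)) (extendZero x (m + 1)))⁻¹ := by
  rw [phiMap_eq, rowAt.eq_2 _ (m + 1), Matrix.vecMul_vecMul,
    Matrix.mul_nonsing_inv _ (isUnit_det_stepMat _ _), Matrix.vecMul_one]

theorem rowAt_apply_pivot_of_phiMap_eq (hv : IsPivot (stepSign (m + 1)) d v)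
    (hx : phiMap n (m + 2) x = v) : rowAt (extendZero x) (m + 1) d = v d := by
  rw [rowAt_eq_phiMap_vecMul, hx,
    (isUnitriangular_stepMat_inv _ _).vecMul_apply_pivot hv.2 (signRank_injective _)]

theorem rowAt_apply_of_lt_of_phiMap_eq (hv : IsPivot (stepSign (m + 1)) d v)
    (hx : phiMap n (m + 2) x = v) {l : Fin n ⊕ Fin n}
    (hl : signRank (stepSign (m + 1)) l < signRank (stepSign (m + 1)) d) :
    rowAt (extendZero x) (m + 1) l = 0 := by
  rw [rowAt_eq_phiMap_vecMul, hx, (isUnitriangular_stepMat_inv _ _).vecMul_apply_of_lt hv.2 hl]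

theorem fiberRetract_eq_self (hv : IsPivot (stepSign (m + 1)) d v)
    (hx : phiMap n (m + 2) x = v) : fiberRetract d v x = x := by
  have hprev : adjustPrev d v x = extendZero x m := by
    refine stepAdjust_self fun l hl => ?_
    rw [← signRank_not_lt_iff, ← stepSign_succ] at hl
    rw [rowAt_apply_of_lt_of_phiMap_eq hv hx hl, hv.2 l hl]
  have hlast : adjustLast d v x = extendZero x (m + 1) := by
    refine stepAdjust_self fun l _ => ?_
    rw [adjustRow, hprev, ← hx, phiMap_eq, rowAt, rowAt]
  have hx₁ : extendZero x m = x ⟨m, by omega⟩ := extendZero_apply x ⟨m, by omega⟩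
  have hx₂ : extendZero x (m + 1) = x ⟨m + 1, by omega⟩ := extendZero_apply x ⟨m + 1, by omega⟩
  rw [fiberRetract, hprev, hlast, hx₁, hx₂, Function.update_eq_self, Function.update_eq_self]

theorem analyticAt_update {G H : Type*} [NormedAddCommGroup G] [NormedSpace ℂ G]
    [NormedAddCommGroup H] [NormedSpace ℂ H] {κ : Type*} [Fintype κ] [DecidableEq κ]
    {f : G → κ → H} {g : G → H} {x : G} (k : κ) (hf : AnalyticAt ℂ f x) (hg : AnalyticAt ℂ g x) :
    AnalyticAt ℂ (fun y => Function.update (f y) k (g y)) x := by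
  refine analyticAt_pi_iff.2 fun j => ?_
  by_cases h : j = k
  · subst h; simpa only [Function.update_self] using hg
  · simpa only [Function.update_of_ne h] using analyticAt_pi_iff.1 hf j

theorem analyticAt_fiberRetract (hd : v d ≠ 0) (x : ParamSpace n (m + 2)) :
    AnalyticAt ℂ (fun p : (Fin n ⊕ Fin n → ℂ) × ParamSpace n (m + 2) => fiberRetract d p.1 p.2)
      (v, x) := by
  set P := (Fin n ⊕ Fin n → ℂ) × ParamSpace n (m + 2)
  have hv (l) : AnalyticAt ℂ (fun p : P => p.1 l) (v, x) := analyticAt_pi_iff.1 analyticAt_fst l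
  have hrow (k l) : AnalyticAt ℂ (fun p : P => rowAt (extendZero p.2) k l) (v, x) :=
    AnalyticAt.fun_comp (g := fun x : ParamSpace n (m + 2) => rowAt (extendZero x) k l)
      (analyticAt_rowAt k x l) analyticAt_snd
  have hext (k) : AnalyticAt ℂ (fun p : P => extendZero p.2 k) (v, x) :=
    AnalyticAt.fun_comp (g := fun x : ParamSpace n (m + 2) => extendZero x k)
      (analyticAt_extendZero k x) analyticAt_snd
  have hprev : AnalyticAt ℂ (fun p : P => adjustPrev d p.1 p.2) (v, x) :=
    analyticAt_stepAdjust (hext m) hd (hrow (m + 1)) hv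
  have hadj (l) : AnalyticAt ℂ (fun p : P => adjustRow d p.1 p.2 l) (v, x) :=
    EntryAnalytic.vecMul (hrow m) (entryAnalytic_stepMat _ hprev) l
  have hlast : AnalyticAt ℂ (fun p : P => adjustLast d p.1 p.2) (v, x) :=
    analyticAt_stepAdjust (hext (m + 1)) hd
      (EntryAnalytic.vecMul hadj (entryAnalytic_stepMat _ (hext (m + 1)))) hv
  exact analyticAt_update _ (analyticAt_update _ analyticAt_snd hprev) hlast

end Retraction

section CriticalPoint

open scoped fwdDiff

variable {n m : ℕ} {d : Fin n ⊕ Fin n} {v : Fin n ⊕ Fin n → ℂ}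

theorem hasFDerivAt_mul_zero {G : Type*} [NormedAddCommGroup G] [NormedSpace ℂ G]
    {f g : G → ℂ} {x : G} (hf : DifferentiableAt ℂ f x) (hg : DifferentiableAt ℂ g x)
    (hfx : f x = 0) (hgx : g x = 0) : HasFDerivAt (fun y => f y * g y) (0 : G →L[ℂ] ℂ) x :=
  (hf.hasFDerivAt.fun_mul hg.hasFDerivAt).congr_fderiv (by rw [hfx, hgx]; ext v; simp)

/-- With `U x := M x * (M z)⁻¹`, where `M x` is the last factor at `x`, the function is
`x ↦ ∑ l, rowAt x (m + 1) l * U x l d`; the terms with `l` in front of the pivot vanish to second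
order at `z`, those behind it are zero, and the one at the pivot is `rowAt x (m + 1) d`. -/
theorem hasFDerivAt_phiMap_dotProduct (hv : IsPivot (stepSign (m + 1)) d v)
    {z : ParamSpace n (m + 2)} (hz : phiMap n (m + 2) z = v) :
    HasFDerivAt (fun x => phiMap n (m + 2) x ⬝ᵥ
        ((stepMat (stepSign (m + 1)) (extendZero z (m + 1)))⁻¹ *ᵥ Pi.single d 1))
      (fderiv ℂ (fun x => rowAt (extendZero x) (m + 1) d) z) z := by
  set s := stepSign (m + 1)
  set r : ParamSpace n (m + 2) → Fin n ⊕ Fin n → ℂ := fun x => rowAt (extendZero x) (m + 1)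
  set N := (stepMat s (extendZero z (m + 1)))⁻¹
  set U := fun x : ParamSpace n (m + 2) => stepMat s (extendZero x (m + 1)) * N
  have hr (l) : DifferentiableAt ℂ (fun x => r x l) z :=
    (analyticAt_rowAt (m + 1) z l).differentiableAt
  have hU (l) : DifferentiableAt ℂ (fun x => U x l d) z :=
    (EntryAnalytic.mul (entryAnalytic_stepMat s (analyticAt_extendZero (m + 1) z))
      (EntryAnalytic.const N z) l d).differentiableAt
  have htri (x) : IsUnitriangular (signRank s) (U x) :=
    (isUnitriangular_stepMat s _).mul (signRank_injective s) (isUnitriangular_stepMat_inv s _)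
  have hUz : U z = 1 := Matrix.mul_nonsing_inv _ (isUnit_det_stepMat s _)
  have hterm : ∀ l ∈ Finset.univ.erase d, HasFDerivAt (fun x => r x l * U x l d)
      (0 : ParamSpace n (m + 2) →L[ℂ] ℂ) z := by
    intro l hl
    have hld := Finset.ne_of_mem_erase hl
    rcases lt_or_gt_of_ne ((signRank_injective s).ne hld) with hlt | hgt
    · exact hasFDerivAt_mul_zero (hr l) (hU l) (rowAt_apply_of_lt_of_phiMap_eq hv hz hlt)
        (by rw [hUz, Matrix.one_apply_ne hld])
    · have hzero (x) : r x l * U x l d = 0 := by rw [(htri x).1 hgt, mul_zero]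
      simpa only [hzero] using hasFDerivAt_const (0 : ℂ) z
  have hexpand (x) : phiMap n (m + 2) x ⬝ᵥ (N *ᵥ Pi.single d 1) =
      r x d + ∑ l ∈ Finset.univ.erase d, r x l * U x l d := by
    have hentry : phiMap n (m + 2) x ⬝ᵥ (N *ᵥ Pi.single d 1) = r x ⬝ᵥ fun l => U x l d := by
      rw [phiMap_eq, rowAt, Matrix.dotProduct_mulVec, Matrix.vecMul_vecMul, dotProduct_single,
        mul_one]
      rfl
    rw [hentry, dotProduct, ← Finset.add_sum_erase _ _ (Finset.mem_univ d), (htri x).2, mul_one]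
  simpa only [hexpand, Finset.sum_const_zero, add_zero] using
    (hr d).hasFDerivAt.fun_add (HasFDerivAt.fun_sum hterm)

theorem exists_fwdDiff_rowAt_ne_zero [NeZero n] (hv : IsPivot (stepSign (m + 1)) d v)
    {z : ParamSpace n (m + 2)} (hz : z ∉ singSet n (m + 2)) (hzv : phiMap n (m + 2) z = v) :
    ∃ i, Δ_[paramDir i] (fun x : ParamSpace n (m + 2) => rowAt (extendZero x) (m + 1) d) z ≠ 0 := by
  by_contra! hzero
  have hfderiv : fderiv ℂ (fun x : ParamSpace n (m + 2) => rowAt (extendZero x) (m + 1) d) z = 0 :=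
    ContinuousLinearMap.coe_injective <| LinearMap.ext_on_range span_range_paramDir fun i =>
      ((affineAlong_rowAt i (m + 1) d).fderiv_apply
        (analyticAt_rowAt (m + 1) z d).differentiableAt).trans (hzero i)
  have hcrit := hasFDerivAt_phiMap_dotProduct hv hzv
  rw [hfderiv] at hcrit
  refine hz (mem_singSet_of_hasFDerivAt_zero (by omega) ?_ hcrit)
  have hinv := (Matrix.isUnit_nonsing_inv_iff).2
    (isUnit_stepMat (stepSign (m + 1)) (extendZero z (m + 1)))
  exact ((Matrix.mulVec_injective_of_isUnit hinv).ne_iff' (Matrix.mulVec_zero _)).2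
    (Pi.single_ne_zero_iff.2 one_ne_zero)

theorem rowAt_eq_baseRow_of_mem_singSet [NeZero n] {K : ℕ} (hK : 1 < K) {x : ParamSpace n K}
    (hx : x ∈ singSet n K) {k : ℕ} (hk : k < K) : rowAt (extendZero x) k = baseRow n := by
  obtain ⟨hfirst, hfix⟩ := (mem_singSet_iff hK x).1 hx
  induction k with
  | zero => rfl
  | succ k ih =>
    rw [rowAt, ih (by omega)]
    rcases k.eq_zero_or_pos with rfl | hk₀
    exacts [hfirst, (hfix k hk₀ hk).1]

theorem colAt_eq_baseRow {X : ℕ → UnitriCoord n × SymCoord n} {j k : ℕ}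
    (h : ∀ i, k ≤ i → i < k + j → stepMat (stepSign i) (X i) *ᵥ baseRow n = baseRow n) :
    colAt X (baseRow n) j k = baseRow n := by
  induction j generalizing k with
  | zero => rfl
  | succ j ih =>
    rw [colAt, ih fun i hki hi => h i (by omega) (by omega), h k le_rfl (by omega)]

theorem rowAt_add_smul_paramDir_eq_one [NeZero n] {K : ℕ} {x : ParamSpace n K}
    (hrow : ∀ k ≤ m, rowAt (extendZero x) k = baseRow n)
    (hcol : ∀ k, 0 < k → k ≤ m →
      stepMat (stepSign k) (extendZero x k) *ᵥ baseRow n = baseRow n)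
    (i : Fin K × ({p : Fin n × Fin n // p.1 < p.2} ⊕ Sym2 (Fin n))) (t : ℂ) :
    rowAt (extendZero (x + t • paramDir i)) (m + 1) (Sum.inr (lastIdx n)) = 1 := by
  rcases lt_or_ge m i.1 with hi | hi
  · rw [rowAt_add_smul_paramDir_of_le i x t hi, rowAt, hrow m le_rfl,
      baseRow_vecMul_stepMat_apply]
  · obtain ⟨j, rfl⟩ := Nat.exists_eq_add_of_le hi
    rw [Nat.add_right_comm, rowAt_add_smul_paramDir, hrow _ hi, ← baseRow_eq,
      colAt_eq_baseRow fun k hk₀ hk => hcol k (by omega) (by omega), dotProduct_comm,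
      baseRow_dotProduct, baseRow_vecMul_stepMat_apply]

theorem fiberRetract_notMem_singSet [NeZero n] (hd : v d ≠ 0) {x : ParamSpace n (m + 2)}
    (hx : rowAt (extendZero x) (m + 1) d = v d)
    (hne : ∃ i, Δ_[paramDir i]
      (fun x : ParamSpace n (m + 2) => rowAt (extendZero x) (m + 1) d) x ≠ 0) :
    fiberRetract d v x ∉ singSet n (m + 2) := by
  intro hmem
  have hrow {k : ℕ} (hk : k < m + 2) := rowAt_eq_baseRow_of_mem_singSet (by omega) hmem hk
  obtain rfl : d = Sum.inr (lastIdx n) := by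
    by_contra hdl
    rw [← hx, ← adjustRow_apply_pivot, ← rowAt_fiberRetract_prev, hrow (Nat.lt_succ_self _),
      baseRow_eq, Pi.single_eq_of_ne hdl] at hd
    exact hd rfl
  have hrow' : ∀ k ≤ m, rowAt (extendZero x) k = baseRow n := fun k hk => by
    rw [← hrow (k := k) (by omega), rowAt_fiberRetract_of_le hk]
  have hcol : ∀ k, 0 < k → k ≤ m →
      stepMat (stepSign k) (extendZero x k) *ᵥ baseRow n = baseRow n := fun k hk₀ hk => by
    have hfix := (((mem_singSet_iff (by omega) _).1 hmem).2 k hk₀ (by omega)).2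
    rcases hk.lt_or_eq with hlt | rfl
    · rwa [extendZero_fiberRetract_of_lt hlt] at hfix
    · rwa [extendZero_fiberRetract_prev, adjustPrev, baseRow_eq,
        stepMat_stepAdjust_mulVec_single, ← baseRow_eq] at hfix
  obtain ⟨i, hi⟩ := hne
  have hone (t : ℂ) := rowAt_add_smul_paramDir_eq_one hrow' hcol i t
  have hstart := hone 0
  have hend := hone 1
  rw [zero_smul, add_zero] at hstart
  rw [one_smul] at hend
  exact hi (by rw [fwdDiff, hstart, hend, sub_self])

end CriticalPoint

/-! ### Surjectivity -/

section Surjectivity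

variable {n m : ℕ}

theorem unitriMatrix_zero : unitriMatrix (0 : UnitriCoord n) = 1 := by
  have hcoord : triCoord (1 : Matrix (Fin n) (Fin n) ℂ) = 0 :=
    funext fun p => Matrix.one_apply_ne p.2.ne
  rw [← hcoord, unitriMatrix_triCoord isUnitriangular_one]

theorem stepMat_zero_fst (z : SymCoord n) :
    stepMat true (0, z) = Matrix.fromBlocks 1 0 (symMatrix z) 1 ∧
      stepMat false (0, z) = Matrix.fromBlocks 1 (symMatrix z) 0 1 := by
  simp [stepMat, elemMinus_eq, elemPlus_eq, unitriMatrix_zero]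

theorem stepMat_zero (s : Bool) : stepMat s (0 : UnitriCoord n × SymCoord n) = 1 := by
  have hsym : symMatrix (0 : SymCoord n) = 0 := rfl
  cases s
  exacts [(stepMat_zero_fst 0).2.trans (by rw [hsym, Matrix.fromBlocks_one]),
    (stepMat_zero_fst 0).1.trans (by rw [hsym, Matrix.fromBlocks_one])]

theorem symMatrix_single_mulVec_single (i j : Fin n) (a c : ℂ) :
    symMatrix (Pi.single s(i, j) a) *ᵥ Pi.single j c = Pi.single i (a * c) := by
  ext k
  by_cases hk : k = i
  · simp [symMatrix, hk]
  · have hne : s(k, j) ≠ s(i, j) := fun h => hk (Sym2.congr_left.1 h)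
    simp [symMatrix, hk, hne]

theorem rowAt_eq_of_eq_zero {X : ℕ → UnitriCoord n × SymCoord n} {k : ℕ}
    (hX : ∀ i, k ≤ i → X i = 0) (j : ℕ) : rowAt X (k + j) = rowAt X k := by
  induction j with
  | zero => rfl
  | succ j ih => rw [← add_assoc, rowAt, hX _ (by omega), stepMat_zero, Matrix.vecMul_one, ih]

variable [NeZero n]

/-- The parameters whose first two factors move the base row to the row with entries `a` in
position `i` of the first half and `b * a` added in position `i` of the second half; the other
factors are trivial. -/
noncomputable def twoStep (i : Fin n) (a b : ℂ) : ℕ → UnitriCoord n × SymCoord n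
  | 0 => (0, Pi.single s(i, lastIdx n) a)
  | 1 => (0, Pi.single s(i, i) b)
  | _ => 0

theorem rowAt_twoStep (i : Fin n) (a b : ℂ) (k : ℕ) : rowAt (twoStep i a b) (2 + k) =
    Sum.elim (Pi.single i a) (lastVec n + Pi.single i (b * a)) := by
  have hfirst : rowAt (twoStep i a b) 1 = Sum.elim (Pi.single i a) (lastVec n) := by
    change baseRow n ᵥ* stepMat true (0, _) = _
    rw [stepMat, baseRow_vecMul_elemMinus (isUnitriangular_unitriMatrix _) (symMatrix_transpose _),
      lastVec_eq, symMatrix_single_mulVec_single, mul_one, unitriMatrix_zero, inv_one,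
      Matrix.one_mulVec]
  have hsym : Pi.single i a ᵥ* symMatrix (Pi.single s(i, i) b) = Pi.single i (b * a) := by
    rw [← Matrix.mulVec_transpose, symMatrix_transpose, symMatrix_single_mulVec_single]
  rw [rowAt_eq_of_eq_zero fun j hj => by obtain ⟨j, rfl⟩ := Nat.exists_eq_add_of_le' hj; rfl]
  change rowAt (twoStep i a b) 1 ᵥ* stepMat false (0, _) = _
  rw [hfirst, (stepMat_zero_fst _).2, Matrix.vecMul_fromBlocks]
  simp [hsym, add_comm]

theorem baseRow_vecMul_twoStep_ne (i : Fin n) {a : ℂ} (ha : a ≠ 0) (b : ℂ) :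
    baseRow n ᵥ* stepMat (stepSign 0) (twoStep i a b 0) ≠ baseRow n := by
  rw [show stepSign 0 = true from rfl, Ne, baseRow_vecMul_stepMat_true_iff, twoStep, lastVec_eq,
    symMatrix_single_mulVec_single, mul_one]
  exact Pi.single_ne_zero_iff.2 ha

theorem exists_rowAt_twoStep_apply (d : Fin n ⊕ Fin n) {c : ℂ} (hc : c ≠ 0) :
    ∃ i a b, a ≠ 0 ∧ ∀ k, rowAt (twoStep (n := n) i a b) (2 + k) d = c := by
  rcases d with i | i
  · exact ⟨i, c, 0, hc, fun k => by simp [rowAt_twoStep]⟩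
  · exact ⟨i, 1, c - lastVec n i, one_ne_zero, fun k => by simp [rowAt_twoStep]⟩

theorem surjOn_phiMap (hm : 1 ≤ m) :
    Set.SurjOn (phiMap n (m + 2)) (singSet n (m + 2))ᶜ {0}ᶜ := by
  intro v hv
  obtain ⟨d, hd⟩ := exists_isPivot (stepSign (m + 1)) hv
  obtain ⟨i, a, b, ha, hrow⟩ := exists_rowAt_twoStep_apply d hd.1
  obtain ⟨k, rfl⟩ := Nat.exists_eq_add_of_le' hm
  set x : ParamSpace n (k + 1 + 2) := fun j => twoStep i a b j
  have hx (j : ℕ) (hj : j < k + 1 + 2) : extendZero x j = twoStep i a b j :=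
    extendZero_apply x ⟨j, hj⟩
  refine ⟨fiberRetract d v x, fun hmem => ?_, phiMap_fiberRetract_eq hd ?_⟩
  · apply baseRow_vecMul_twoStep_ne i ha b
    rw [← hx 0 (by omega), ← extendZero_fiberRetract_of_lt (d := d) (v := v) k.succ_pos]
    exact ((mem_singSet_iff (by omega) _).1 hmem).1
  · rw [rowAt_congr fun j hj => hx j (by omega), ← hrow k, Nat.add_comm 2 k]

end Surjectivity

/-! ### The stratification -/

section Stratification

variable {n : ℕ} {s : Bool} {k : ℕ} {v : Fin n ⊕ Fin n → ℂ}

/-- The closed subspaces of the stratification: the nonzero rows whose first `2 n - 1 - k`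
coordinates, in the order given by `signRank s`, vanish. -/
def flagSet (s : Bool) (k : ℕ) : Set (Fin n ⊕ Fin n → ℂ) :=
  {v | v ≠ 0 ∧ ∀ l, signRank s l < 2 * n - 1 - k → v l = 0}

theorem flagSet_top : flagSet (n := n) s (2 * n - 1) = {0}ᶜ := by
  ext v
  simp [flagSet]

theorem flagSet_mono : Monotone (flagSet (n := n) s) :=
  fun _ _ hjk _ hv => ⟨hv.1, fun l hl => hv.2 l (by omega)⟩

theorem mem_stratum_flagSet_of_isPivot {d : Fin n ⊕ Fin n} (hk : k ≤ 2 * n - 1)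
    (hd : signRank s d = 2 * n - 1 - k) (hv : IsPivot s d v) : v ∈ stratum (flagSet s) k := by
  have hmem : v ∈ flagSet s k := ⟨fun hzero => hv.1 (congrFun hzero d), fun l hl =>
    hv.2 l (hd.symm ▸ hl)⟩
  cases k with
  | zero => exact hmem
  | succ k => exact ⟨hmem, fun hsucc => hv.1 (hsucc.2 d (by omega))⟩

theorem mem_stratum_flagSet_iff (hk : k ≤ 2 * n - 1) :
    v ∈ stratum (flagSet s) k ↔ ∃ d, signRank s d = 2 * n - 1 - k ∧ IsPivot s d v := by
  refine ⟨fun hv => ?_, fun ⟨d, hd, hpivot⟩ => mem_stratum_flagSet_of_isPivot hk hd hpivot⟩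
  have hmem : v ∈ flagSet s k := by
    cases k with
    | zero => exact hv
    | succ k => exact hv.1
  obtain ⟨d, hd⟩ := exists_isPivot s hmem.1
  have hlower : 2 * n - 1 - k ≤ signRank s d := not_lt.1 fun hlt => hd.1 (hmem.2 d hlt)
  refine ⟨d, le_antisymm ?_ hlower, hd⟩
  cases k with
  | zero => exact Nat.le_sub_one_of_lt (pivotRank_lt _)
  | succ k =>
    by_contra! hlt
    exact hv.2 ⟨hmem.1, fun l hl => hd.2 l (by omega)⟩

/-- The tuple of the coordinates satisfying `p`. -/
noncomputable def coordMap (p : Fin n ⊕ Fin n → Prop) [DecidablePred p] :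
    (Fin n ⊕ Fin n → ℂ) →L[ℂ] (Fin (Fintype.card {l // p l}) → ℂ) :=
  ContinuousLinearMap.pi fun a => ContinuousLinearMap.proj ((Fintype.equivFin {l // p l}).symm a).1

theorem coordMap_eq_zero_iff (p : Fin n ⊕ Fin n → Prop) [DecidablePred p]
    (v : Fin n ⊕ Fin n → ℂ) : coordMap p v = 0 ↔ ∀ l, p l → v l = 0 := by
  rw [funext_iff, (Fintype.equivFin {l // p l}).symm.forall_congr_left, Subtype.forall]
  simp [coordMap]

theorem coordMap_surjective (p : Fin n ⊕ Fin n → Prop) [DecidablePred p] :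
    Function.Surjective (coordMap p) := by
  intro w
  refine ⟨fun l => if h : p l then w (Fintype.equivFin {l // p l} ⟨l, h⟩) else 0, ?_⟩
  ext a
  simp [coordMap, ((Fintype.equivFin {l // p l}).symm a).2]

theorem isClosedComplexSubspace_flagSet (s : Bool) (k : ℕ) :
    IsClosedComplexSubspace (flagSet s k) ({0}ᶜ : Set (Fin n ⊕ Fin n → ℂ)) := by
  refine ⟨fun v hv => hv.1, fun v hv => ⟨{0}ᶜ, _,
    coordMap fun l => signRank s l < 2 * n - 1 - k, isOpen_compl_singleton, hv, subset_rfl,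
    fun u _ => (coordMap _).analyticAt u, ?_⟩⟩
  ext u
  simp only [coordMap_eq_zero_iff, flagSet, Set.mem_inter_iff, Set.mem_ofPred_eq,
    Set.mem_compl_singleton_iff]
  tauto

theorem isRegularSubspace_stratum_flagSet (hk : k ≤ 2 * n - 1) :
    IsRegularSubspace (stratum (flagSet (n := n) s) k) := by
  intro v hv
  obtain ⟨d, hd, hpivot⟩ := (mem_stratum_flagSet_iff hk).1 hv
  refine ⟨{u | u d ≠ 0}, _, coordMap fun l => signRank s l < signRank s d,
    isOpen_ne_fun (continuous_apply d) continuous_const, hpivot.1,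
    fun u _ => (coordMap _).analyticAt u, fun u _ => ?_, ?_⟩
  · rw [ContinuousLinearMap.fderiv]
    exact coordMap_surjective _
  · ext u
    simp only [Set.mem_inter_iff, Set.mem_ofPred_eq, coordMap_eq_zero_iff]
    constructor
    · rintro ⟨hu, hud⟩
      obtain ⟨d', hd', hpivot'⟩ := (mem_stratum_flagSet_iff hk).1 hu
      obtain rfl := signRank_injective s (hd'.trans hd.symm)
      exact ⟨hud, hpivot'.2⟩
    · exact fun hu => ⟨mem_stratum_flagSet_of_isPivot hk hd hu, hu.1⟩

theorem admitsDominatingFiberSpray_phiMap [NeZero n] {m : ℕ} {d : Fin n ⊕ Fin n}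
    {W : Set (ParamSpace n (m + 2))} (hWZ : W ⊆ (singSet n (m + 2))ᶜ)
    (hW : ∀ z ∈ W, IsPivot (stepSign (m + 1)) d (phiMap n (m + 2) z)) :
    AdmitsDominatingFiberSpray (phiMap n (m + 2)) (singSet n (m + 2))ᶜ W := by
  have hpivot {z x} (hz : z ∈ W) (hxz : phiMap n (m + 2) x = phiMap n (m + 2) z) :
      rowAt (extendZero x) (m + 1) d = phiMap n (m + 2) z d :=
    rowAt_apply_pivot_of_phiMap_eq (hW z hz) hxz
  refine (isHolomorphicSubmersion_phiMap (by omega)).admitsDominatingFiberSpray_of_retraction hWZ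
    (f := fun x => rowAt (extendZero x) (m + 1) d) (R := fiberRetract d)
    (fun x => analyticAt_rowAt (m + 1) x d) span_range_paramDir
    (fun i => affineAlong_rowAt i (m + 1) d)
    (fun z hz x => analyticAt_fiberRetract (hW z hz).1 x)
    (fun z hz => exists_fwdDiff_rowAt_ne_zero (hW z hz) (hWZ hz) rfl)
    (fun z hz x hxz hne => ?_)
    fun z hz x _ hxz => ⟨(hpivot hz hxz).trans (hpivot hz rfl).symm,
      fiberRetract_eq_self (hW z hz) hxz⟩
  have hx := hxz.trans (hpivot hz rfl)
  exact ⟨fiberRetract_notMem_singSet (hW z hz).1 hx hne, phiMap_fiberRetract_eq (hW z hz) hx⟩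

end Stratification

theorem proposition3p3_general (n K : ℕ) [NeZero n] (hK : 3 ≤ K) :
    IsStratifiedEllipticSubmersion (phiMap n K) (singSet n K)ᶜ
      ({0}ᶜ : Set (Fin n ⊕ Fin n → ℂ)) := by
  obtain ⟨m, rfl⟩ : ∃ m, K = m + 2 := ⟨K - 2, by omega⟩
  refine ⟨isHolomorphicSubmersion_phiMap (by omega), surjOn_phiMap (by omega), 2 * n - 1,
    flagSet (stepSign (m + 1)), flagSet_top, fun k _ => flagSet_mono k.le_succ,
    fun k _ => isClosedComplexSubspace_flagSet _ k,
    fun k hk => ⟨isRegularSubspace_stratum_flagSet hk, fun v hv => ?_⟩⟩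
  obtain ⟨d, hd, -⟩ := (mem_stratum_flagSet_iff hk).1 hv
  refine ⟨Set.univ, isOpen_univ, Set.mem_univ v,
    admitsDominatingFiberSpray_phiMap (d := d) Set.inter_subset_left ?_⟩
  rintro z ⟨-, hz, -⟩
  obtain ⟨d', hd', hpivot⟩ := (mem_stratum_flagSet_iff hk).1 hz
  rwa [← signRank_injective _ (hd'.trans hd.symm)]

theorem proposition3p3 (n K : ℕ) (hn : 2 ≤ n) (hK : 3 ≤ K) :
    IsStratifiedEllipticSubmersion (phiMap n K) (singSet n K)ᶜ
      ({0}ᶜ : Set (Fin n ⊕ Fin n → ℂ)) := by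
  have : NeZero n := ⟨by omega⟩
  exact proposition3p3_general n K hK
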